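/- Let $p$ be a prime, $n\ge 2$, and let $\pi$ be an irreducible admissible (smooth) representation of $\mathrm{GL}_n(\mathbb{Q}_p)\times\mathbb{Q}_p^\times$ over a field $E$ of characteristic $0$ (for example $E=\mathbb{C}$). Let $I_n\subseteq \mathrm{GL}_n(\mathbb{Z}_p)$ be the Iwahori subgroup of matrices whose reduction mod $p$ is upper triangular, and $Iw_p=I_n\times\mathbb{Z}_p^\times$. Let $P=P_M\times\mathbb{Q}_p^\times$, where $P_M\subseteq\mathrm{GL}_n(\mathbb{Q}_p)$ is the block upper triangular parabolic with blocks of sizes $1,n-1$; let $L_P=\mathbb{Q}_p^\times\times\mathrm{GL}_{n-1}(\mathbb{Q}_p)\times\mathbb{Q}_p^\times$ be its block diagonal Levi subgroup, $N$ its unipotent radical, and $\delta_P(g)=|\det(\mathrm{Ad}(g)\,|\,\mathrm{Lie}\,N)|_p$ its modular character. Put $Iw_{Ig}=\mathbb{Z}_p^\times\times I_{n-1}\times\mathbb{Z}_p^\times\subseteq L_P$. Let $\pi_N$ be the space of $N$-coinvariants of $\pi$ (the unnormalized Jacquet module) with its induced action of $L_P$. For a subgroup $K$ and an element $g$, the double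 coset $KgK$ acts on $K$-invariants by $v\mapsto\sum_{xK\subseteq KgK}xv$. Let $\mathcal{U}^-$ be the monoid of symbols $U(a_1,\dots,a_n,b)$ with integers $a_1\ge\dots\ge a_n$ and $b$, with $U(a,b)\,U(a',b')=U(a+a',b+b')$. Let $U(a_1,\dots,a_n,b)$ act on $\pi^{Iw_p}$ by the double coset $Iw_p\,(\mathrm{diag}(p^{a_1},\dots,p^{a_n}),p^b)\,Iw_p$, and on $(\pi_N)^{Iw_{Ig}}\otimes\delta_P^{-1}$ by $\delta_P(t)^{-1}$ times the double coset $Iw_{Ig}\,t\,Iw_{Ig}$, where $t=(p^{a_1},\mathrm{diag}(p^{a_2},\dots,p^{a_n}),p^b)\in L_P$. Then these formulas define $\mathcal{U}^-$-module structures on $\pi^{Iw_p}$ and on $(\pi_N)^{Iw_{Ig}}\otimes\delta_P^{-1}$, and the natural map $$\pi^{Iw_p}\longrightarrow(\pi_N)^{Iw_{Ig}}\otimes\delta_P^{-1},$$ induced by the quotient map $\pi\to\pi_N$, is an isomorphism of $\mathcal{U}^-$-modules. -/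

import Mathlib

open scoped MatrixGroups

namespace IwahoriJacquet

noncomputable section

/-! ### Smooth and admissible representations, Hecke operators -/

section General

variable {E G V : Type*} [Field E] [Group G] [AddCommGroup V] [Module E V]

/-- The space `V^H` of vectors fixed by the subgroup `H`. -/
abbrev fixedBy (ρ : Representation E G V) (H : Subgroup G) : Submodule E V :=
  Representation.invariants (ρ.comp H.subtype)

/-- `ρ` is smooth: every vector has an open stabiliser. -/
def IsSmooth [TopologicalSpace G] (ρ : Representation E G V) : Prop :=
  ∀ v : V, ∃ H : Subgroup G, IsOpen (H : Set G) ∧ v ∈ fixedBy ρ H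

/-- `ρ` is admissible: it is smooth, and `V^H` is finite-dimensional for every compact open
subgroup `H`. -/
def IsAdmissible [TopologicalSpace G] (ρ : Representation E G V) : Prop :=
  IsSmooth ρ ∧ ∀ H : Subgroup G, IsOpen (H : Set G) → IsCompact (H : Set G) →
    FiniteDimensional E (fixedBy ρ H)

theorem apply_out_eq (ρ : Representation E G V) (H : Subgroup G) {v : V}
    (hv : v ∈ fixedBy ρ H) (x : G) (q : G ⧸ H) (hq : (x : G ⧸ H) = q) :
    ρ q.out v = ρ x v := by
  have h : x⁻¹ * q.out ∈ H := by
    rw [← QuotientGroup.eq, hq, QuotientGroup.out_eq']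
  have h2 : ρ (x⁻¹ * q.out) v = v := hv ⟨_, h⟩
  have h3 : ρ (x * (x⁻¹ * q.out)) v = ρ x v := by
    rw [map_mul, Module.End.mul_apply, h2]
  simpa using h3

/-- The double coset `H g H` acts on `V^H` by `v ↦ ∑ ρ(x) v`, where `xH` runs over the left cosets
contained in `H g H`, that is, over the `H`-orbit of `gH` in `G ⧸ H`. On `V^H` the summand does not
depend on the representative `x` of the coset (`apply_out_eq`), and the orbit is finite when `H` is
compact and open. -/
def heckeOperator (ρ : Representation E G V) (H : Subgroup G) (g : G) :
    Module.End E (fixedBy ρ H) :=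
  LinearMap.restrict (∑ᶠ q : MulAction.orbit H (g : G ⧸ H), ρ (q : G ⧸ H).out) <| by
    intro v hv k
    change ρ k _ = _
    by_cases hfin : Finite (MulAction.orbit H (g : G ⧸ H))
    · have := Fintype.ofFinite (MulAction.orbit H (g : G ⧸ H))
      rw [finsum_eq_sum_of_fintype, LinearMap.sum_apply, map_sum]
      refine Fintype.sum_equiv (MulAction.toPerm k) _ _ fun q => ?_
      rw [← Module.End.mul_apply, ← map_mul]
      refine (apply_out_eq ρ H hv _ _ ?_).symm
      change ((k : G) • (((q : G ⧸ H).out : G) : G ⧸ H)) = _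
      rw [QuotientGroup.out_eq']
      rfl
    · rcases subsingleton_or_nontrivial V with hV | hV
      · exact Subsingleton.elim _ _
      · rw [finsum_of_infinite_support]
        · simp
        · have hs : (Function.support fun q : MulAction.orbit H (g : G ⧸ H) =>
              ρ (q : G ⧸ H).out) = Set.univ := by
            ext q
            simp only [Function.mem_support, Set.mem_univ, iff_true]
            intro h0
            obtain ⟨w, hw⟩ := exists_ne (0 : V)
            apply hw
            have h1 : ρ ((q : G ⧸ H).out⁻¹ * (q : G ⧸ H).out) w = 0 := by
              rw [map_mul, h0]; simp
            simpa using h1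
          rw [hs, Set.infinite_univ_iff]
          exact not_finite_iff_infinite.mp hfin

end General

/-! ### Iwahori subgroups -/

/-- The Borel subgroup of upper triangular matrices in `GL_n(k)`. -/
def upperBorel (n : ℕ) (k : Type*) [Field k] : Subgroup (GL (Fin n) k) where
  carrier := {g | ∀ i j, j < i → g i j = 0}
  mul_mem' {a b} ha hb := by
    have h := Matrix.BlockTriangular.mul (M := (a : Matrix (Fin n) (Fin n) k))
      (N := (b : Matrix (Fin n) (Fin n) k)) (b := id) (fun i j h => ha i j h)
      (fun i j h => hb i j h)
    exact fun i j hij => h hij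
  one_mem' i j hij := by simp [hij.ne']
  inv_mem' {a} ha := by
    have := Units.invertible a
    have h := Matrix.blockTriangular_inv_of_blockTriangular
      (M := (a : Matrix (Fin n) (Fin n) k)) (b := id) (fun i j h => ha i j h)
    intro i j hij
    have h2 := h hij
    rwa [← Matrix.coe_units_inv] at h2

variable (p : ℕ) [Fact p.Prime]

/-- The Iwahori subgroup of `GL_n(ℚ_p)`: the matrices in `GL_n(ℤ_p)` whose reduction in `GL_n(𝔽_p)`
is upper triangular. -/
def iwahori (n : ℕ) : Subgroup (GL (Fin n) ℚ_[p]) :=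
  ((upperBorel n (ZMod p)).comap
    (Matrix.GeneralLinearGroup.map (PadicInt.toZMod (p := p)))).map
      (Matrix.GeneralLinearGroup.map (PadicInt.Coe.ringHom (p := p)))

/-- `ℤ_p^×` as a subgroup of `ℚ_p^×`. -/
def integralUnits : Subgroup ℚ_[p]ˣ :=
  (Units.map (PadicInt.Coe.ringHom (p := p)).toMonoidHom).range

/-- `GL_n(ℚ_p) × ℚ_p^×`. -/
abbrev GG (n : ℕ) : Type := GL (Fin n) ℚ_[p] × ℚ_[p]ˣ

/-- `Iw_p = I_n × ℤ_p^×`. -/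
def Iw (n : ℕ) : Subgroup (GG p n) := (iwahori p n).prod (integralUnits p)

/-! ### The parabolic of type `(1, m)`, its Levi subgroup and unipotent radical

Here `n = m + 1`. -/

variable (m : ℕ)

/-- The Levi subgroup `L_P = ℚ_p^× × GL_m(ℚ_p) × ℚ_p^×`, as an abstract group. -/
abbrev Levi : Type := ℚ_[p]ˣ × GL (Fin m) ℚ_[p] × ℚ_[p]ˣ

/-- `Iw_Ig`, as the subgroup `ℤ_p^× × I_m × ℤ_p^×` of `L_P`. -/
def IwIg : Subgroup (Levi p m) := (integralUnits p).prod ((iwahori p m).prod (integralUnits p))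

variable {p m}

theorem inv_col {g : GL (Fin (m + 1)) ℚ_[p]} (hg : ∀ i : Fin m, g i.succ 0 = 0) (j : Fin (m + 1)) :
    (g⁻¹ : GL (Fin (m + 1)) ℚ_[p]) j 0 * g 0 0 = (1 : Matrix (Fin (m + 1)) (Fin (m + 1)) ℚ_[p]) j 0
    := by
  have h : ((g⁻¹ : GL (Fin (m + 1)) ℚ_[p]) : Matrix (Fin (m + 1)) (Fin (m + 1)) ℚ_[p]) *
      (g : Matrix (Fin (m + 1)) (Fin (m + 1)) ℚ_[p]) = 1 := by simp
  have h2 := congrFun (congrFun h j) 0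
  rw [Matrix.mul_apply, Fin.sum_univ_succ] at h2
  simpa [hg] using h2

variable (p m)

/-- The parabolic `P = P_M × ℚ_p^×`, where `P_M` is the stabiliser in `GL_{m+1}(ℚ_p)` of the line
spanned by the first basis vector: block upper triangular matrices with blocks of sizes `1, m`. -/
def parabolic : Subgroup (GG p (m + 1)) where
  carrier := {g | ∀ i : Fin m, g.1 i.succ 0 = 0}
  mul_mem' {a b} ha hb i := by
    have ha' := ha i
    simp only [Prod.fst_mul, Units.val_mul, Matrix.mul_apply, Fin.sum_univ_succ]
    rw [ha', Finset.sum_eq_zero fun j _ => by rw [hb j, mul_zero]]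
    simp
  one_mem' i := by simp
  inv_mem' {a} ha i := by
    have h0 := inv_col ha 0
    have hi := inv_col ha i.succ
    have hne : a.1 0 0 ≠ 0 := by
      intro h
      rw [h] at h0
      simp at h0
    rw [Matrix.one_apply_ne (Fin.succ_ne_zero i)] at hi
    exact (mul_eq_zero.mp hi).resolve_right hne

/-- The upper left entry, as a character of `P`. -/
def parabolicCorner : parabolic p m →* ℚ_[p]ˣ :=
  MonoidHom.toHomUnits
    { toFun := fun g => g.1.1 0 0
      map_one' := by simp
      map_mul' := fun a b => by
        have hb := b.2
        simp only [Subgroup.coe_mul, Prod.fst_mul, Units.val_mul, Matrix.mul_apply,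
          Fin.sum_univ_succ]
        rw [Finset.sum_eq_zero fun j _ => by rw [hb j, mul_zero], add_zero] }

/-- The lower right `m × m` block, as a homomorphism from `P` to `GL_m(ℚ_p)`. -/
def parabolicBlock : parabolic p m →* GL (Fin m) ℚ_[p] :=
  MonoidHom.toHomUnits
    { toFun := fun g => Matrix.of fun i j => g.1.1 i.succ j.succ
      map_one' := by ext i j; simp [Matrix.one_apply]
      map_mul' := fun a b => by
        ext i j
        have ha := a.2 i
        simp only [Subgroup.coe_mul, Prod.fst_mul, Units.val_mul, Matrix.mul_apply,
          Fin.sum_univ_succ, Matrix.of_apply]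
        rw [ha, zero_mul, zero_add] }

/-- The projection of `P` onto its Levi quotient. -/
def leviProj : parabolic p m →* Levi p m :=
  (parabolicCorner p m).prod ((parabolicBlock p m).prod
    ((MonoidHom.snd _ _).comp (parabolic p m).subtype))

/-- The unipotent radical `N` of `P`: the elements `([1, x; 0, 1], 1)`. -/
def unipotentRadical : Subgroup (parabolic p m) := (leviProj p m).ker

instance : (unipotentRadical p m).Normal := by
  unfold unipotentRadical; infer_instance

/-- The block diagonal matrix `diag(a, g)`. -/
def blockDiagHom : ℚ_[p] × Matrix (Fin m) (Fin m) ℚ_[p] →*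
    Matrix (Fin (m + 1)) (Fin (m + 1)) ℚ_[p] where
  toFun x := Matrix.of (Fin.cons (Fin.cons x.1 0) fun i => Fin.cons 0 (x.2 i))
  map_one' := by
    ext i j
    refine Fin.cases ?_ (fun i => ?_) i <;> refine Fin.cases ?_ (fun j => ?_) j <;>
      simp [Matrix.one_apply, Fin.succ_ne_zero, (Fin.succ_ne_zero _).symm]
  map_mul' x y := by
    ext i j
    refine Fin.cases ?_ (fun i => ?_) i <;> refine Fin.cases ?_ (fun j => ?_) j <;>
      simp [Matrix.mul_apply, Fin.sum_univ_succ]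

/-- The embedding of `L_P` into `P` as block diagonal matrices. -/
def leviEmb : Levi p m →* parabolic p m where
  toFun l := ⟨(Units.map (blockDiagHom p m) (MulEquiv.prodUnits.symm (l.1, l.2.1)), l.2.2),
    fun i => by simp [blockDiagHom]⟩
  map_one' := by
    apply Subtype.ext
    refine Prod.ext ?_ rfl
    change Units.map (blockDiagHom p m) (MulEquiv.prodUnits.symm 1) = 1
    simp
  map_mul' x y := by
    apply Subtype.ext
    refine Prod.ext ?_ rfl
    change Units.map (blockDiagHom p m) (MulEquiv.prodUnits.symm ((x.1, x.2.1) * (y.1, y.2.1))) = _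
    rw [map_mul, map_mul]
    rfl

/-- The Lie algebra of `N`: matrices vanishing outside the places `(0, j)` with `j ≠ 0`. -/
def lieN : Submodule ℚ_[p] (Matrix (Fin (m + 1)) (Fin (m + 1)) ℚ_[p]) where
  carrier := {X | X 0 0 = 0 ∧ ∀ (i : Fin m) (j : Fin (m + 1)), X i.succ j = 0}
  add_mem' {X Y} hX hY := ⟨by simp [hX.1, hY.1], fun i j => by simp [hX.2, hY.2]⟩
  zero_mem' := ⟨rfl, fun _ _ => rfl⟩
  smul_mem' c X hX := ⟨by simp [hX.1], fun i j => by simp [hX.2]⟩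

theorem conj_mem_lieN (g : parabolic p m) (X : Matrix (Fin (m + 1)) (Fin (m + 1)) ℚ_[p])
    (hX : X ∈ lieN p m) :
    (g.1.1 : Matrix (Fin (m + 1)) (Fin (m + 1)) ℚ_[p]) * X *
      ((g⁻¹).1.1 : Matrix (Fin (m + 1)) (Fin (m + 1)) ℚ_[p]) ∈ lieN p m := by
  have hg := g.2
  have hg' := (g⁻¹).2
  have key : ∀ i j, ((g.1.1 : Matrix (Fin (m + 1)) (Fin (m + 1)) ℚ_[p]) * X) i j =
      g.1.1 i 0 * X 0 j := by
    intro i j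
    rw [Matrix.mul_apply, Fin.sum_univ_succ,
      Finset.sum_eq_zero fun k _ => by rw [hX.2 k j, mul_zero], add_zero]
  refine ⟨?_, fun i j => ?_⟩
  · rw [Matrix.mul_apply, Fin.sum_univ_succ, key, hX.1,
      Finset.sum_eq_zero fun k _ => by rw [hg' k, mul_zero]]
    simp
  · rw [Matrix.mul_apply]
    refine Finset.sum_eq_zero fun k _ => ?_
    rw [key, hg i]
    simp

/-- The adjoint action `X ↦ g X g⁻¹` of `P` on the Lie algebra of `N` (the factor `ℚ_p^×` acts
trivially). -/
def adN : Representation ℚ_[p] (parabolic p m) (lieN p m) where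
  toFun g :=
    { toFun := fun X => ⟨_, conj_mem_lieN p m g X.1 X.2⟩
      map_add' := fun X Y => Subtype.ext (by simp [mul_add, add_mul])
      map_smul' := fun c X => Subtype.ext (by simp) }
  map_one' := by
    refine LinearMap.ext fun X => Subtype.ext ?_
    simp
  map_mul' a b := by
    refine LinearMap.ext fun X => Subtype.ext ?_
    simp [mul_assoc]

/-- The modular character `δ_P(g) = |det(Ad(g) | Lie N)|_p` of `P`, with values in the coefficient
field `E`; here `|p|_p = p⁻¹`. -/
def modularChar (E : Type*) [Field E] [CharZero E] : parabolic p m →* E :=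
  (Rat.castHom E).toMonoidHom.comp
    (((padicNormE (p := p)).toMonoidWithZeroHom.toMonoidHom).comp
      (LinearMap.det.comp (adN p m)))

/-! ### The monoid `U⁻` -/

/-- The monoid of all `(a_1 ≥ ... ≥ a_n, b)`, which indexes the double cosets `U(a_1, ..., a_n, b)`;
`U(x) U(y) = U(x + y)`. -/
def dominant (n : ℕ) : AddSubmonoid ((Fin n → ℤ) × ℤ) where
  carrier := {x | Antitone x.1}
  add_mem' ha hb := Antitone.add ha hb
  zero_mem' := antitone_const

/-- `U⁻`, written multiplicatively. -/
abbrev Uminus (n : ℕ) : Type := Multiplicative (dominant n)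

/-- `p` as an element of `ℚ_p^×`. -/
def pUnit : ℚ_[p]ˣ := Units.mk0 (p : ℚ_[p]) (by exact_mod_cast (Fact.out : p.Prime).ne_zero)

/-- `diag(p^{a_1}, ..., p^{a_n})`. -/
def diagPow {n : ℕ} (a : Fin n → ℤ) : GL (Fin n) ℚ_[p] :=
  Units.map (Matrix.diagonalRingHom (Fin n) ℚ_[p]).toMonoidHom
    (MulEquiv.piUnits.symm fun i => pUnit p ^ a i)

/-- `(diag(p^{a_1}, ..., p^{a_n}), p^b)` in `GL_n(ℚ_p) × ℚ_p^×`. -/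
def torusElt {n : ℕ} (u : Uminus n) : GG p n :=
  (diagPow p (Multiplicative.toAdd u).1.1, pUnit p ^ (Multiplicative.toAdd u).1.2)

/-- `(p^{a_1}, diag(p^{a_2}, ..., p^{a_n}), p^b)` in `L_P`. -/
def torusEltLevi (u : Uminus (m + 1)) : Levi p m :=
  (pUnit p ^ (Multiplicative.toAdd u).1.1 0,
    diagPow p (fun i : Fin m => (Multiplicative.toAdd u).1.1 i.succ),
    pUnit p ^ (Multiplicative.toAdd u).1.2)

/-! ### The Jacquet module -/

section Jacquet

variable {p m} {E V : Type*} [Field E] [AddCommGroup V] [Module E V]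
variable (π : Representation E (GG p (m + 1)) V)

/-- The space of `N`-coinvariants `π_N = V / span {π(x) v - v | x ∈ N, v ∈ V}`. -/
abbrev JacquetModule : Type _ :=
  Representation.Coinvariants
    ((π.comp (parabolic p m).subtype).comp (unipotentRadical p m).subtype)

/-- The quotient map `V → π_N`. -/
abbrev jacquetMk : V →ₗ[E] JacquetModule π :=
  Representation.Coinvariants.mk
    ((π.comp (parabolic p m).subtype).comp (unipotentRadical p m).subtype)

/-- The unnormalised action of `L_P` on `π_N`, induced by `π`. -/
def jacquet : Representation E (Levi p m) (JacquetModule π) :=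
  (Representation.toCoinvariants (π.comp (parabolic p m).subtype) (unipotentRadical p m)).comp
    (leviEmb p m)

end Jacquet

end

end IwahoriJacquet

open IwahoriJacquet

/-! Everything is computed modulo augmentation submodules, the spans of the vectors `ρ k u - u` with
`k ∈ K`. If every vector is fixed by a subgroup of finite index in `K` and the characteristic is 0,
averaging shows that a `K`-fixed vector in this span vanishes, so fixed vectors are equal once they
are congruent (`fixed_eq_of_sub_mem`). On an `H`-fixed vector the double coset of `g` is congruent
to `[H : H ∩ gHg⁻¹]` times `g`; if `H = K (H ∩ gHg⁻¹)`, this holds already modulo the smaller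
augmentation of `K` (`heckeOperator_sub_mem`).

A dominant torus element `t` contracts upper triangular matrices, and `t⁻¹` contracts lower
triangular ones (`isPositive_torusElt`). Hence the Hecke operators multiply (`heckeOperator_mul`),
and the congruence for `t` can be pushed to `π_N`, where `Iw_p ∩ P` acts through `Iw_Ig`.
Equivariance thereby becomes an identity of indices: the index in `Iw_p` is the index in `Iw_Ig`
times `[N₀ : t N₀ t⁻¹]`, and the latter is `δ_P(t)⁻¹` (`relIndex_Iw_eq`, `modularChar_torus`).

Bijectivity rests on `t_s = diag(p^s, 1, …, 1)`, which is central in `L_P`. Its Hecke operator is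
injective, because `diag(p, 1, …, 1)` is a length-additive product of adjacent transpositions, each
with injective operator, times an element normalising the Iwahori subgroup
(`firstWeight_one_criterion`). If a fixed `v` dies in `π_N`, then `t_s v` lies in the augmentation
of `Iw_p` for large `s`, since `t_s` contracts `N`; so the operator of `t_s` kills `v`, and `v = 0`
(`jacquetMk_injective`). Conversely, the `t_s`-translate of a fixed vector of `π_N` lifts to
`π^{Iw_p}` by averaging (`exists_lift_of_fixed`). By admissibility the injective operator of `t_s`
is bijective there, which undoes the translation (`jacquetMk_surjective`). The module structure on
the Jacquet side is transported along the resulting isomorphism. -/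

namespace IwahoriJacquet

noncomputable section

/-! ### Conjugate subgroups and indices -/

section Groups

variable {G : Type*} [Group G]

/-- The conjugate `g H g⁻¹`. -/
def conjSubgroup (g : G) (H : Subgroup G) : Subgroup G :=
  H.comap (MulAut.conj g⁻¹).toMonoidHom

theorem mem_conjSubgroup {g x : G} {H : Subgroup G} :
    x ∈ conjSubgroup g H ↔ g⁻¹ * x * g ∈ H := by
  simp [conjSubgroup, Subgroup.mem_comap]

theorem conjSubgroup_mul (g h : G) (H : Subgroup G) :
    conjSubgroup (g * h) H = conjSubgroup g (conjSubgroup h H) := by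
  ext x
  simp [mem_conjSubgroup, mul_assoc]

theorem conjSubgroup_eq_map (g : G) (H : Subgroup G) :
    conjSubgroup g H = H.map (MulAut.conj g).toMonoidHom := by
  ext x
  rw [mem_conjSubgroup, Subgroup.mem_map]
  constructor
  · intro h
    exact ⟨_, h, by simp [mul_assoc]⟩
  · rintro ⟨y, hy, rfl⟩
    simpa [mul_assoc] using hy

theorem relIndex_conjSubgroup (g : G) (H K : Subgroup G) :
    (conjSubgroup g H).relIndex (conjSubgroup g K) = H.relIndex K := by
  rw [conjSubgroup_eq_map, conjSubgroup_eq_map]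
  exact Subgroup.relIndex_map_map_of_injective _ _ (MulAut.conj g).injective

/-- If `H = K A`, then `[H : H ∩ A] = [K : K ∩ A]`. -/
theorem relIndex_eq_of_factor {A H K : Subgroup G} (hKH : K ≤ H)
    (h : ∀ x ∈ H, ∃ k ∈ K, k⁻¹ * x ∈ A) : A.relIndex H = A.relIndex K := by
  symm
  refine Nat.card_congr (Equiv.ofBijective
    (Quotient.map' (Subgroup.inclusion hKH) ?_) ⟨?_, ?_⟩)
  · intro a b hab
    rw [QuotientGroup.leftRel_apply] at hab ⊢
    simpa [Subgroup.mem_subgroupOf] using hab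
  · intro a b
    induction a using QuotientGroup.induction_on with | _ a
    induction b using QuotientGroup.induction_on with | _ b
    intro hab
    have h2 : ((Subgroup.inclusion hKH a : H) : H ⧸ A.subgroupOf H) =
      ((Subgroup.inclusion hKH b : H) : H ⧸ A.subgroupOf H) := hab
    rw [QuotientGroup.eq] at h2 ⊢
    simpa [Subgroup.mem_subgroupOf] using h2
  · intro x
    induction x using QuotientGroup.induction_on with | _ x
    obtain ⟨k, hk, hx⟩ := h x x.2
    refine ⟨((⟨k, hk⟩ : K) : K ⧸ A.subgroupOf K), ?_⟩
    change ((Subgroup.inclusion hKH ⟨k, hk⟩ : H) : H ⧸ A.subgroupOf H) = _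
    rw [QuotientGroup.eq, Subgroup.mem_subgroupOf]
    simpa using hx

theorem stabilizer_mk (H : Subgroup G) (g : G) :
    MulAction.stabilizer H (g : G ⧸ H) = (conjSubgroup g H).subgroupOf H := by
  ext x
  rw [MulAction.mem_stabilizer_iff, Subgroup.mem_subgroupOf, mem_conjSubgroup]
  change (((x : G) * g : G) : G ⧸ H) = _ ↔ _
  rw [eq_comm, QuotientGroup.eq, mul_assoc]

theorem card_orbit_mk (H : Subgroup G) (g : G) :
    Nat.card (MulAction.orbit H (g : G ⧸ H)) = (conjSubgroup g H).relIndex H := by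
  rw [Subgroup.relIndex, ← stabilizer_mk, MulAction.index_stabilizer]
  rfl

theorem finite_orbit_mk {H : Subgroup G} {g : G} (h : (conjSubgroup g H).relIndex H ≠ 0) :
    Finite (MulAction.orbit H (g : G ⧸ H)) := by
  rw [← card_orbit_mk] at h
  exact Nat.finite_of_card_ne_zero h

/-- Multiplicativity of the indices `[K : g K g⁻¹]` along contracting elements. -/
theorem relIndex_conjSubgroup_mul {K : Subgroup G} {g g' : G} (hg : conjSubgroup g K ≤ K)
    (hg' : conjSubgroup g' K ≤ K) :
    (conjSubgroup (g * g') K).relIndex K =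
      (conjSubgroup g K).relIndex K * (conjSubgroup g' K).relIndex K := by
  have h : conjSubgroup (g * g') K ≤ conjSubgroup g K := by
    rw [conjSubgroup_mul]
    intro x hx
    rw [mem_conjSubgroup] at hx ⊢
    exact hg' hx
  -- In the tower `gg'K(gg')⁻¹ ≤ gKg⁻¹ ≤ K` the lower step is the `g`-conjugate of `g'Kg'⁻¹ ≤ K`.
  rw [← Subgroup.relIndex_mul_relIndex _ _ _ h hg, conjSubgroup_mul, relIndex_conjSubgroup,
    mul_comm]

end Groups

/-! ### Coinvariants and averages -/

section Averages

variable {E G V : Type*} [Field E] [Group G] [AddCommGroup V] [Module E V]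
variable (ρ : Representation E G V)

theorem mem_fixedBy {H : Subgroup G} {v : V} : v ∈ fixedBy ρ H ↔ ∀ h ∈ H, ρ h v = v :=
  ⟨fun hv h hh => hv ⟨h, hh⟩, fun hv h => hv h h.2⟩

/-- The span of all `ρ(k) u - u` with `k ∈ K`. -/
def augmentation (K : Subgroup G) : Submodule E V :=
  Submodule.span E {x | ∃ k ∈ K, ∃ u, x = ρ k u - u}

variable {ρ}

theorem sub_mem_augmentation {K : Subgroup G} {k : G} (hk : k ∈ K) (u : V) :
    ρ k u - u ∈ augmentation ρ K :=
  Submodule.subset_span ⟨k, hk, u, rfl⟩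

theorem augmentation_le {K : Subgroup G} {W : Submodule E V}
    (h : ∀ k ∈ K, ∀ u, ρ k u - u ∈ W) : augmentation ρ K ≤ W := by
  refine Submodule.span_le.mpr ?_
  rintro _ ⟨k, hk, u, rfl⟩
  exact h k hk u

theorem augmentation_mono {K K' : Subgroup G} (h : K ≤ K') :
    augmentation ρ K ≤ augmentation ρ K' :=
  augmentation_le fun _ hk u => sub_mem_augmentation (h hk) u

theorem apply_mem_augmentation {K K' : Subgroup G} {g : G} (h : ∀ k ∈ K, g * k * g⁻¹ ∈ K')
    {x : V} (hx : x ∈ augmentation ρ K) : ρ g x ∈ augmentation ρ K' := by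
  suffices H : augmentation ρ K ≤ (augmentation ρ K').comap (ρ g) from H hx
  refine augmentation_le fun k hk u => ?_
  have := sub_mem_augmentation (ρ := ρ) (h k hk) (ρ g u)
  simpa [← Module.End.mul_apply, ← map_mul, mul_assoc] using this

variable (ρ) in
/-- Every vector is fixed by a subgroup meeting `K` in a subgroup of finite index. -/
def IsLocallyFinite (K : Subgroup G) : Prop :=
  ∀ v, ∃ S : Subgroup G, S.relIndex K ≠ 0 ∧ v ∈ fixedBy ρ S

/-- An element of an augmentation submodule involves finitely many vectors `u`; this provides one
subgroup that fixes them all. -/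
theorem IsLocallyFinite.finset {K : Subgroup G} (h : IsLocallyFinite ρ K) (s : Finset V) :
    ∃ S : Subgroup G, S.relIndex K ≠ 0 ∧ ∀ v ∈ s, v ∈ fixedBy ρ S := by
  classical
  induction s using Finset.induction_on with
  | empty => exact ⟨K, by simp, by simp⟩
  | insert a s _ ih =>
    obtain ⟨S, hS, hs⟩ := ih
    obtain ⟨T, hT, ha⟩ := h a
    refine ⟨S ⊓ T, Subgroup.relIndex_inf_ne_zero hS hT, fun v hv => ?_⟩
    rw [mem_fixedBy]
    intro x hx
    rcases Finset.mem_insert.mp hv with rfl | hv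
    · exact (mem_fixedBy ρ).mp ha x hx.2
    · exact (mem_fixedBy ρ).mp (hs v hv) x hx.1

/-- For a locally finite action in characteristic zero, the invariants meet the augmentation
submodule trivially. -/
theorem eq_zero_of_fixed_of_mem_augmentation [CharZero E] {K : Subgroup G}
    (h : IsLocallyFinite ρ K) {x : V} (hx : x ∈ fixedBy ρ K) (hx' : x ∈ augmentation ρ K) :
    x = 0 := by
  classical
  obtain ⟨c, rfl⟩ := (Finsupp.mem_span_iff_linearCombination E _ _).mp hx'
  have hch : ∀ y : {x | ∃ k ∈ K, ∃ u, x = ρ k u - u}, ∃ k ∈ K, ∃ u, (y : V) = ρ k u - u :=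
    fun y => y.2
  choose k hk u hu using hch
  obtain ⟨S, hS, hSu⟩ := h.finset (c.support.image u)
  -- Passing to the normal core makes `K ⧸ N` a finite group. Summing over it kills each generator
  -- `ρ k u - u` in play, but multiplies a `K`-fixed vector by `|K ⧸ N|`, which is nonzero in
  -- characteristic 0.
  let N : Subgroup K := (S.subgroupOf K).normalCore
  have : (S.subgroupOf K).FiniteIndex := ⟨hS⟩
  have : Fintype (K ⧸ N) := Subgroup.fintypeQuotientOfFiniteIndex
  let σ : Representation E K V := ρ.comp K.subtype
  let T : Module.End E V := ∑ q : K ⧸ N, σ q.out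
  have hT : ∀ y ∈ c.support, T (y : V) = 0 := by
    intro y hy
    have hfix : u y ∈ fixedBy σ N := by
      intro n
      have hn : (n : K) ∈ S.subgroupOf K := Subgroup.normalCore_le _ n.2
      exact (mem_fixedBy ρ).mp (hSu _ (Finset.mem_image_of_mem u hy)) _
        (Subgroup.mem_subgroupOf.mp hn)
    have hTk : T (ρ (k y) (u y)) = T (u y) := by
      simp only [T, LinearMap.sum_apply]
      refine Fintype.sum_equiv (Equiv.mulRight ((⟨k y, hk y⟩ : K) : K ⧸ N)) _ _ fun q => ?_
      rw [apply_out_eq σ N hfix (q.out * ⟨k y, hk y⟩), map_mul]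
      · rfl
      · simp
    rw [hu y, map_sub, hTk, sub_self]
  have h0 : T (Finsupp.linearCombination E Subtype.val c) = 0 := by
    rw [Finsupp.linearCombination_apply, Finsupp.sum, map_sum]
    exact Finset.sum_eq_zero fun y hy => by rw [map_smul, hT y hy, smul_zero]
  set x := Finsupp.linearCombination E Subtype.val c
  have h1 : T x = (Fintype.card (K ⧸ N) : E) • x := by
    simp only [T, LinearMap.sum_apply]
    rw [Finset.sum_congr rfl fun q _ => hx q.out]
    simp [← Nat.cast_smul_eq_nsmul E]
  rw [h1, smul_eq_zero] at h0
  exact h0.resolve_left (Nat.cast_ne_zero.mpr Fintype.card_ne_zero)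

/-- The form in which the vanishing is used: identities between invariant vectors need only be
checked up to terms `ρ k u - u`. -/
theorem fixed_eq_of_sub_mem [CharZero E] {K : Subgroup G} (h : IsLocallyFinite ρ K) {x y : V}
    (hx : x ∈ fixedBy ρ K) (hy : y ∈ fixedBy ρ K) (hxy : x - y ∈ augmentation ρ K) : x = y :=
  sub_eq_zero.mp (eq_zero_of_fixed_of_mem_augmentation h (Submodule.sub_mem _ hx hy) hxy)

/-- If `H = K L` and `w` is fixed by `L`, the average of `w` over `H` agrees with its average
over `K`. -/
theorem exists_average [CharZero E] {H K : Subgroup G} (hlf : IsLocallyFinite ρ H) (w : V)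
    (h : ∀ x ∈ H, ∃ k ∈ K, ρ (k⁻¹ * x) w = w) :
    ∃ w' ∈ fixedBy ρ H, w' - w ∈ augmentation ρ K := by
  classical
  obtain ⟨S, hS, hw⟩ := hlf w
  have : (S.subgroupOf H).FiniteIndex := ⟨hS⟩
  have hw' : w ∈ fixedBy (ρ.comp H.subtype) (S.subgroupOf H) := fun n =>
    (mem_fixedBy ρ).mp hw _ (Subgroup.mem_subgroupOf.mp n.2)
  -- The average is taken over the finite orbit `H w`, which `H` permutes, rather than over a coset
  -- space.
  let O : Set V := Set.range fun x : H => ρ x w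
  have hO : O.Finite := by
    refine (Set.finite_range fun q : H ⧸ S.subgroupOf H => ρ q.out w).subset ?_
    rintro _ ⟨x, rfl⟩
    exact ⟨(x : H ⧸ S.subgroupOf H), apply_out_eq (ρ.comp H.subtype) _ hw' x _ rfl⟩
  have hne : (hO.toFinset.card : E) ≠ 0 := by
    rw [Nat.cast_ne_zero, Finset.card_ne_zero]
    exact ⟨w, by simpa [O] using ⟨1, H.one_mem, by simp⟩⟩
  refine ⟨(hO.toFinset.card : E)⁻¹ • ∑ y ∈ hO.toFinset, y, ?_, ?_⟩
  · rw [mem_fixedBy]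
    intro x hx
    rw [map_smul, map_sum]
    congr 1
    refine Finset.sum_bij (fun y _ => ρ x y) ?_ ?_ ?_ fun _ _ => rfl
    · intro y hy
      rw [Set.Finite.mem_toFinset] at hy ⊢
      obtain ⟨z, rfl⟩ := hy
      exact ⟨⟨x, hx⟩ * z, by simp⟩
    · intro y _ z _ hyz
      simpa using congrArg (ρ x⁻¹) hyz
    · intro y hy
      rw [Set.Finite.mem_toFinset] at hy
      obtain ⟨z, rfl⟩ := hy
      refine ⟨ρ (x⁻¹ * z) w, ?_, by simp⟩
      rw [Set.Finite.mem_toFinset]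
      exact ⟨⟨x, hx⟩⁻¹ * z, by simp⟩
  · have : (hO.toFinset.card : E)⁻¹ • ∑ y ∈ hO.toFinset, y - w =
        (hO.toFinset.card : E)⁻¹ • ∑ y ∈ hO.toFinset, (y - w) := by
      rw [Finset.sum_sub_distrib, smul_sub, Finset.sum_const, ← Nat.cast_smul_eq_nsmul E,
        inv_smul_smul₀ hne]
    rw [this]
    refine Submodule.smul_mem _ _ (Submodule.sum_mem _ fun y hy => ?_)
    rw [Set.Finite.mem_toFinset] at hy
    obtain ⟨z, rfl⟩ := hy
    -- Each orbit point `z w` equals `k w` with `k ∈ K`, so only generators coming from `K` occur.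
    obtain ⟨k, hk, hz⟩ := h z z.2
    have : ρ (z : G) w = ρ k w := by
      rw [map_mul, Module.End.mul_apply] at hz
      simpa using congrArg (ρ k) hz
    change ρ (z : G) w - w ∈ _
    rw [this]
    exact sub_mem_augmentation hk w

end Averages

/-! ### Hecke operators as averages -/

section Hecke

variable {E G V : Type*} [Field E] [Group G] [AddCommGroup V] [Module E V]
variable {ρ : Representation E G V}

theorem heckeOperator_apply {H : Subgroup G} {g : G} [Fintype (MulAction.orbit H (g : G ⧸ H))]
    (v : fixedBy ρ H) : (heckeOperator ρ H g v : V) =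
      ∑ q : MulAction.orbit H (g : G ⧸ H), ρ (q : G ⧸ H).out v := by
  change (∑ᶠ q : MulAction.orbit H (g : G ⧸ H), ρ (q : G ⧸ H).out) (v : V) = _
  rw [finsum_eq_sum_of_fintype, LinearMap.sum_apply]

/-- Each coset in `HgH` has a representative `hg` with `h ∈ H`, whose contribution differs from `g
v` by a generator; the number of cosets is the index. -/
theorem heckeOperator_sub_mem_self {H : Subgroup G} {g : G}
    (hfin : (conjSubgroup g H).relIndex H ≠ 0) (v : fixedBy ρ H) :
    (heckeOperator ρ H g v : V) - ((conjSubgroup g H).relIndex H : E) • ρ g v ∈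
      augmentation ρ H := by
  have := finite_orbit_mk hfin
  have := Fintype.ofFinite (MulAction.orbit H (g : G ⧸ H))
  rw [heckeOperator_apply, ← card_orbit_mk, Nat.card_eq_fintype_card, Nat.cast_smul_eq_nsmul,
    ← Finset.card_univ, ← Finset.sum_const, ← Finset.sum_sub_distrib]
  refine Submodule.sum_mem _ fun q _ => ?_
  obtain ⟨h, hq⟩ := q.2
  rw [apply_out_eq ρ H v.2 (h * g) _ hq, map_mul]
  exact sub_mem_augmentation h.2 _

/-- The free scalar `d` makes room for the twist by `δ_P⁻¹` in the comparison with the Jacquet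
module. -/
theorem smul_heckeOperator_eq_of_sub_mem [CharZero E] {H : Subgroup G} {g : G}
    (hlf : IsLocallyFinite ρ H) (hfin : (conjSubgroup g H).relIndex H ≠ 0) (v : fixedBy ρ H)
    {x : V} (hx : x ∈ fixedBy ρ H) {d : E}
    (h : x - (d * ((conjSubgroup g H).relIndex H : E)) • ρ g v ∈ augmentation ρ H) :
    x = d • (heckeOperator ρ H g v : V) := by
  refine fixed_eq_of_sub_mem hlf hx (Submodule.smul_mem _ _ (Subtype.coe_prop _)) ?_
  convert Submodule.sub_mem _ h
    (Submodule.smul_mem _ d (heckeOperator_sub_mem_self hfin v)) using 1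
  module

theorem apply_mem_fixedBy_of_comm {H : Subgroup G} {g : G} (hg : ∀ h, h * g = g * h) {v : V}
    (hv : v ∈ fixedBy ρ H) : ρ g v ∈ fixedBy ρ H := by
  rw [mem_fixedBy] at hv ⊢
  intro h hh
  rw [← Module.End.mul_apply, ← map_mul, hg, map_mul, Module.End.mul_apply, hv h hh]

theorem eq_of_apply_eq {g : G} {v w : V} (h : ρ g v = ρ g w) : v = w := by
  simpa using congrArg (ρ g⁻¹) h

/-- If `H = K (H ∩ g H g⁻¹)`, then `[H g H]` is `[H : H ∩ g H g⁻¹]` times `g`, modulo the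
augmentation submodule of `K`. -/
theorem heckeOperator_sub_mem [CharZero E] {H K : Subgroup G} {g : G} (hlf : IsLocallyFinite ρ H)
    (hKH : K ≤ H) (hfin : (conjSubgroup g H).relIndex H ≠ 0)
    (h : ∀ x ∈ H, ∃ k ∈ K, k⁻¹ * x ∈ conjSubgroup g H) (v : fixedBy ρ H) :
    (heckeOperator ρ H g v : V) - ((conjSubgroup g H).relIndex H : E) • ρ g v ∈
      augmentation ρ K := by
  -- Since `g H g⁻¹` fixes `g v`, averaging `g v` over `H` changes it only by the augmentation of
  -- `K`. The Hecke operator must then be the index times this average, as both are `H`-fixed and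
  -- congruent modulo the augmentation of `H`.
  obtain ⟨w, hw, hwg⟩ := exists_average hlf (K := K) (ρ g v) fun x hx => by
    obtain ⟨k, hk, hkx⟩ := h x hx
    refine ⟨k, hk, ?_⟩
    rw [mem_conjSubgroup] at hkx
    have := (mem_fixedBy ρ).mp v.2 _ hkx
    simpa [← Module.End.mul_apply, ← map_mul, mul_assoc] using congrArg (ρ g) this
  set c : E := ((conjSubgroup g H).relIndex H : E)
  have h1 : (heckeOperator ρ H g v : V) = c • w := by
    refine fixed_eq_of_sub_mem hlf (heckeOperator ρ H g v).2 (Submodule.smul_mem _ _ hw) ?_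
    have h2 := Submodule.sub_mem _ (heckeOperator_sub_mem_self hfin v)
      (Submodule.smul_mem _ c (augmentation_mono hKH hwg))
    convert h2 using 1
    module
  rw [h1, ← smul_sub]
  exact Submodule.smul_mem _ _ hwg

/-- The element `g` is positive with respect to the subgroup `K` of `H`: `H = K (H ∩ g H g⁻¹)`,
`K ∩ g H g⁻¹ = g K g⁻¹`, and `[H : H ∩ g H g⁻¹]` is finite. -/
structure IsPositive {G : Type*} [Group G] (H K : Subgroup G) (g : G) : Prop where
  factor : ∀ x ∈ H, ∃ k ∈ K, k⁻¹ * x ∈ conjSubgroup g H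
  inter : conjSubgroup g H ⊓ K = conjSubgroup g K
  finite : (conjSubgroup g H).relIndex H ≠ 0

theorem IsPositive.le {H K : Subgroup G} {g : G} (h : IsPositive H K g) :
    conjSubgroup g K ≤ K :=
  h.inter ▸ inf_le_right

theorem IsPositive.relIndex_eq {H K : Subgroup G} {g : G} (h : IsPositive H K g) (hKH : K ≤ H) :
    (conjSubgroup g H).relIndex H = (conjSubgroup g K).relIndex K := by
  rw [relIndex_eq_of_factor hKH h.factor, ← h.inter, Subgroup.inf_relIndex_right]

/-- Multiplicativity of Hecke operators for positive elements. -/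
theorem heckeOperator_mul [CharZero E] {H K : Subgroup G} {g g' : G} (hlf : IsLocallyFinite ρ H)
    (hKH : K ≤ H) (hg : IsPositive H K g) (hg' : IsPositive H K g')
    (hgg' : IsPositive H K (g * g')) :
    heckeOperator ρ H (g * g') = heckeOperator ρ H g * heckeOperator ρ H g' := by
  refine LinearMap.ext fun v => Subtype.ext ?_
  refine fixed_eq_of_sub_mem hlf (Subtype.coe_prop _) (Subtype.coe_prop _) ?_
  have h1 := heckeOperator_sub_mem_self hgg'.finite v
  have h2 := heckeOperator_sub_mem_self hg.finite (heckeOperator ρ H g' v)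
  have h3 := heckeOperator_sub_mem hlf hKH hg'.finite hg'.factor v
  -- Here the refinement from `H` to `K` is needed: `g` conjugates `K` into itself by positivity,
  -- but need not conjugate `H` into itself.
  have h4 : ρ g ((heckeOperator ρ H g' v : V) - ((conjSubgroup g' H).relIndex H : E) • ρ g' v) ∈
      augmentation ρ H := by
    refine apply_mem_augmentation (fun k hk => hKH (hg.le ?_)) h3
    rw [mem_conjSubgroup]
    simpa [mul_assoc] using hk
  -- The indices in `H` are replaced by those in `K`, where they are multiplicative because `g` and
  -- `g'` contract `K`.
  rw [hgg'.relIndex_eq hKH, relIndex_conjSubgroup_mul hg.le hg'.le, ← hg.relIndex_eq hKH,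
    ← hg'.relIndex_eq hKH] at h1
  have h5 := Submodule.sub_mem _ h1 (Submodule.add_mem _ h2 (Submodule.smul_mem _
    ((conjSubgroup g H).relIndex H : E) h4))
  convert h5 using 1
  rw [map_mul, Module.End.mul_apply, Module.End.mul_apply, map_sub, map_smul]
  push_cast
  module

/-- Injectivity criterion for products of length-additive elements. -/
theorem injective_criterion_mul [CharZero E] {H K : Subgroup G} {g g' : G}
    (hlf : IsLocallyFinite ρ H) (hKH : K ≤ H)
    (hfin : (conjSubgroup g' H).relIndex H ≠ 0)
    (h : ∀ x ∈ H, ∃ k ∈ K, k⁻¹ * x ∈ conjSubgroup g' H)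
    (hgK : ∀ k ∈ K, g * k * g⁻¹ ∈ H)
    (hg : ∀ v ∈ fixedBy ρ H, ρ g v ∈ augmentation ρ H → v = 0)
    (hg' : ∀ v ∈ fixedBy ρ H, ρ g' v ∈ augmentation ρ H → v = 0) :
    ∀ v ∈ fixedBy ρ H, ρ (g * g') v ∈ augmentation ρ H → v = 0 := by
  intro v hv hgv
  set c : E := ((conjSubgroup g' H).relIndex H : E)
  have hc : c ≠ 0 := Nat.cast_ne_zero.mpr hfin
  have h1 := heckeOperator_sub_mem hlf hKH hfin h ⟨v, hv⟩
  have h2 : (heckeOperator ρ H g' ⟨v, hv⟩ : V) = 0 := by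
    refine hg _ (heckeOperator ρ H g' ⟨v, hv⟩).2 ?_
    -- Applying `g` to the congruence `[H g' H] v ≡ c g' v` modulo the augmentation of `K` lands in
    -- that of `H`, by `hgK`; so `g [H g' H] v` lies there too, and the criterion for `g` applies.
    have h3 := Submodule.add_mem _ (apply_mem_augmentation hgK h1) (Submodule.smul_mem _ c hgv)
    convert h3 using 1
    simp [c]
  rw [h2, zero_sub, Submodule.neg_mem_iff, Submodule.smul_mem_iff _ hc] at h1
  exact hg' v hv (augmentation_mono hKH h1)

/-- If `H ∪ H s H` is a subgroup and `s² = 1`, then `[H s H]` is injective. -/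
theorem injective_criterion_reflection [CharZero E] {H : Subgroup G} {s : G}
    (hlf : IsLocallyFinite ρ H) (hfin : (conjSubgroup s H).relIndex H ≠ 0)
    (hs : s * s = 1)
    (h : ∀ x ∈ H, s * x * s ∈ H ∨ ∃ a ∈ H, ∃ b ∈ H, s * x * s = a * s * b) :
    ∀ v ∈ fixedBy ρ H, ρ s v ∈ augmentation ρ H → v = 0 := by
  classical
  intro v hv hsv
  -- The idea is that `[HsH] v = 0` makes `v` equal to the sum of its translates over the cosets in
  -- `H ∪ HsH`, a sum that is invariant under `s`. Then `v = s v` is both fixed and in the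
  -- augmentation.
  suffices hfix : ρ s v = v from eq_zero_of_fixed_of_mem_augmentation hlf hv (hfix ▸ hsv)
  by_cases hsH : s ∈ H
  · exact (mem_fixedBy ρ).mp hv s hsH
  have := finite_orbit_mk hfin
  have := Fintype.ofFinite (MulAction.orbit H (s : G ⧸ H))
  have h0 : (heckeOperator ρ H s ⟨v, hv⟩ : V) = 0 := by
    refine eq_zero_of_fixed_of_mem_augmentation hlf (heckeOperator ρ H s ⟨v, hv⟩).2 ?_
    have h1 := Submodule.add_mem _ (heckeOperator_sub_mem_self hfin ⟨v, hv⟩)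
      (Submodule.smul_mem _ ((conjSubgroup s H).relIndex H : E) hsv)
    convert h1 using 1
    simp
  rw [heckeOperator_apply] at h0
  let O : Finset (G ⧸ H) := (MulAction.orbit H (s : G ⧸ H)).toFinset
  have hsum : ∑ q ∈ O, ρ q.out v = 0 := by
    rw [← h0]
    exact Finset.sum_subtype O (fun q => by simp [O]) fun q : G ⧸ H => ρ q.out v
  have h1O : ((1 : G) : G ⧸ H) ∉ O := by
    simp only [O, Set.mem_toFinset]
    rintro ⟨x, hx⟩
    have hx' : (((x : G) * s : G) : G ⧸ H) = ((1 : G) : G ⧸ H) := hx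
    rw [eq_comm, QuotientGroup.eq] at hx'
    apply hsH
    simpa using H.mul_mem (H.inv_mem x.2) hx'
  have hv1 : ∑ q ∈ insert ((1 : G) : G ⧸ H) O, ρ q.out v = v := by
    rw [Finset.sum_insert h1O, hsum, add_zero, apply_out_eq ρ H hv 1 _ rfl]
    simp
  -- Left translation by `s` preserves the set of cosets in `H ∪ HsH`; for `HsH` this uses the
  -- dichotomy `sxs ∈ H` or `sxs ∈ HsH`.
  have hmem : ∀ q ∈ insert ((1 : G) : G ⧸ H) O, s • q ∈ insert ((1 : G) : G ⧸ H) O := by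
    intro q hq
    rw [Finset.mem_insert] at hq ⊢
    rcases hq with rfl | hq
    · right
      simp only [O, Set.mem_toFinset]
      refine ⟨1, ?_⟩
      change ((1 * s : G) : G ⧸ H) = ((s * 1 : G) : G ⧸ H)
      rw [mul_one, one_mul]
    · simp only [O, Set.mem_toFinset] at hq ⊢
      obtain ⟨x, rfl⟩ := hq
      have e1 : s • (fun m : H => m • (s : G ⧸ H)) x = ((s * x * s : G) : G ⧸ H) := by
        rw [mul_assoc]; rfl
      rw [e1]
      rcases h x x.2 with hx | ⟨a, ha, b, hb, hx⟩
      · left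
        rw [eq_comm, QuotientGroup.eq]
        simpa using hx
      · right
        refine ⟨⟨a, ha⟩, ?_⟩
        change ((a * s : G) : G ⧸ H) = _
        rw [QuotientGroup.eq, hx]
        simpa [mul_assoc] using hb
  have hss : ∀ q : G ⧸ H, s • s • q = q := fun q => by rw [smul_smul, hs, one_smul]
  conv_lhs => rw [← hv1]
  conv_rhs => rw [← hv1]
  rw [map_sum]
  refine Finset.sum_bij (fun q _ => s • q) hmem ?_ ?_ ?_
  · intro a _ b _ hab
    exact smul_left_cancel s hab
  · intro q hq
    exact ⟨s • q, hmem q hq, hss q⟩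
  · intro q _
    rw [← Module.End.mul_apply, ← map_mul]
    refine (apply_out_eq ρ H hv _ _ ?_).symm
    change s • ((q.out : G) : G ⧸ H) = _
    rw [QuotientGroup.out_eq']

end Hecke

/-! ### Matrix elements -/

section Elements

variable {n : ℕ} {F : Type*} [Field F]

/-- The matrix `1 + ∑ c_i E_{ik}`, where `c_k = 0`. -/
def colUnip (k : Fin n) (c : Fin n → F) (hc : c k = 0) : GL (Fin n) F where
  val := 1 + Matrix.vecMulVec c (Pi.single k 1)
  inv := 1 - Matrix.vecMulVec c (Pi.single k 1)
  val_inv := by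
    have h : Matrix.vecMulVec c (Pi.single k 1) * Matrix.vecMulVec c (Pi.single k (1 : F)) = 0 := by
      simp [Matrix.vecMulVec_mul_vecMulVec, hc]
    rw [add_mul, mul_sub, mul_sub, h]
    simp
  inv_val := by
    have h : Matrix.vecMulVec c (Pi.single k 1) * Matrix.vecMulVec c (Pi.single k (1 : F)) = 0 := by
      simp [Matrix.vecMulVec_mul_vecMulVec, hc]
    rw [sub_mul, mul_add, mul_add, h]
    simp

theorem colUnip_inv (k : Fin n) (c : Fin n → F) (hc : c k = 0) :
    (colUnip k c hc)⁻¹ = colUnip k (-c) (by simp [hc]) := by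
  refine Units.ext ?_
  change (1 - Matrix.vecMulVec c (Pi.single k 1) : Matrix (Fin n) (Fin n) F) =
    1 + Matrix.vecMulVec (-c) (Pi.single k 1)
  rw [Matrix.neg_vecMulVec, sub_eq_add_neg]

theorem colUnip_apply (k : Fin n) (c : Fin n → F) (hc : c k = 0) (i j : Fin n) :
    colUnip k c hc i j = (1 : Matrix (Fin n) (Fin n) F) i j + if j = k then c i else 0 := by
  change (1 + Matrix.vecMulVec c (Pi.single k 1) : Matrix (Fin n) (Fin n) F) i j = _
  simp [Matrix.vecMulVec_apply, Pi.single_apply]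

theorem colUnip_mul_apply (k : Fin n) (c : Fin n → F) (hc : c k = 0) (g : GL (Fin n) F)
    (i j : Fin n) : (colUnip k c hc * g) i j = g i j + c i * g k j := by
  rw [Units.val_mul, Matrix.mul_apply]
  simp only [colUnip_apply, add_mul, Finset.sum_add_distrib, ite_mul, zero_mul]
  simp [Matrix.one_apply]

/-- The permutation matrix sending `e_j` to `e_{σ j}`. -/
def permGL (σ : Equiv.Perm (Fin n)) : GL (Fin n) F where
  val := Matrix.of fun i j => if i = σ j then 1 else 0
  inv := Matrix.of fun i j => if σ i = j then 1 else 0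
  val_inv := by
    ext i j
    simp only [Matrix.mul_apply, Matrix.of_apply, ite_mul, one_mul, zero_mul]
    rw [Finset.sum_eq_single (σ.symm i)]
    · simp [Matrix.one_apply]
    · intro b _ hb
      rw [if_neg]
      rintro rfl
      simp at hb
    · simp
  inv_val := by
    ext i j
    simp [Matrix.mul_apply, Matrix.one_apply]

theorem permGL_mul_apply (σ : Equiv.Perm (Fin n)) (g : GL (Fin n) F) (i j : Fin n) :
    (permGL σ * g : GL (Fin n) F) i j = g (σ.symm i) j := by
  rw [Units.val_mul, Matrix.mul_apply, Finset.sum_eq_single (σ.symm i)]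
  · simp [permGL]
  · intro b _ hb
    have : i ≠ σ b := by
      rintro rfl
      simp at hb
    simp [permGL, this]
  · simp

theorem mul_permGL_apply (σ : Equiv.Perm (Fin n)) (g : GL (Fin n) F) (i j : Fin n) :
    (g * permGL σ : GL (Fin n) F) i j = g i (σ j) := by
  rw [Units.val_mul, Matrix.mul_apply, Finset.sum_eq_single (σ j)]
  · simp [permGL]
  · intro b _ hb
    simp [permGL, hb]
  · simp

theorem permGL_one : permGL (1 : Equiv.Perm (Fin n)) = (1 : GL (Fin n) F) := by
  refine Units.ext (Matrix.ext fun i j => ?_)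
  by_cases h : i = j <;> simp [permGL, h]

theorem permGL_mul (σ τ : Equiv.Perm (Fin n)) :
    (permGL (σ * τ) : GL (Fin n) F) = permGL σ * permGL τ := by
  refine Units.ext (Matrix.ext fun i j => ?_)
  have h := mul_permGL_apply τ (permGL σ : GL (Fin n) F) i j
  exact Eq.trans rfl h.symm

theorem permGL_inv (σ : Equiv.Perm (Fin n)) : (permGL σ : GL (Fin n) F)⁻¹ = permGL σ⁻¹ := by
  rw [inv_eq_iff_mul_eq_one, ← permGL_mul, mul_inv_cancel, permGL_one]

theorem permGL_conj_apply (σ : Equiv.Perm (Fin n)) (g : GL (Fin n) F) (i j : Fin n) :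
    (permGL σ * g * (permGL σ)⁻¹ : GL (Fin n) F) i j = g (σ.symm i) (σ.symm j) := by
  rw [permGL_inv, mul_permGL_apply, permGL_mul_apply]
  rfl

end Elements

/-! ### Diagonal matrices of powers of `p`. -/

section Diag

variable (p : ℕ) [Fact p.Prime] {n : ℕ}

theorem diagPow_coe (a : Fin n → ℤ) :
    (diagPow p a : Matrix (Fin n) (Fin n) ℚ_[p]) =
      Matrix.diagonal fun i => (p : ℚ_[p]) ^ a i := by
  change Matrix.diagonal _ = _
  congr 1
  funext i
  simp [pUnit]

theorem diagPow_mul_apply (a : Fin n → ℤ) (g : GL (Fin n) ℚ_[p]) (i j : Fin n) :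
    (diagPow p a * g) i j = (p : ℚ_[p]) ^ a i * g i j := by
  rw [Units.val_mul, diagPow_coe, Matrix.diagonal_mul]

theorem mul_diagPow_apply (a : Fin n → ℤ) (g : GL (Fin n) ℚ_[p]) (i j : Fin n) :
    (g * diagPow p a) i j = g i j * (p : ℚ_[p]) ^ a j := by
  rw [Units.val_mul, diagPow_coe, Matrix.mul_diagonal]

theorem padic_p_ne_zero : (p : ℚ_[p]) ≠ 0 := by
  exact_mod_cast (Fact.out : p.Prime).ne_zero

theorem diagPow_add (a b : Fin n → ℤ) : diagPow p (a + b) = diagPow p a * diagPow p b := by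
  refine Units.ext ?_
  rw [Units.val_mul, diagPow_coe, diagPow_coe, diagPow_coe, Matrix.diagonal_mul_diagonal]
  congr 1
  funext i
  exact zpow_add₀ (padic_p_ne_zero p) _ _

theorem diagPow_zero : diagPow p (0 : Fin n → ℤ) = 1 := by
  refine Units.ext ?_
  rw [diagPow_coe]
  simp

theorem diagPow_inv (a : Fin n → ℤ) : (diagPow p a)⁻¹ = diagPow p (-a) := by
  rw [inv_eq_iff_mul_eq_one, ← diagPow_add, add_neg_cancel, diagPow_zero]

theorem diagPow_inv_conj_apply (a : Fin n → ℤ) (g : GL (Fin n) ℚ_[p]) (i j : Fin n) :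
    ((diagPow p a)⁻¹ * g * diagPow p a) i j = (p : ℚ_[p]) ^ (a j - a i) * g i j := by
  rw [mul_diagPow_apply, diagPow_inv, diagPow_mul_apply, Pi.neg_apply, sub_eq_add_neg,
    zpow_add₀ (padic_p_ne_zero p)]
  ring

theorem norm_p_zpow (k : ℤ) : ‖(p : ℚ_[p]) ^ k‖ = (p : ℝ) ^ (-k) := by
  rw [norm_zpow, Padic.norm_p, inv_zpow, zpow_neg]

theorem norm_p_zpow_le_one {k : ℤ} (hk : 0 ≤ k) : ‖(p : ℚ_[p]) ^ k‖ ≤ 1 := by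
  rw [norm_p_zpow]
  exact zpow_le_one_of_nonpos₀ (by exact_mod_cast (Fact.out : p.Prime).one_lt.le) (by omega)

end Diag

/-! ### The Iwahori subgroup in terms of norms -/

section Iwahori

variable {p : ℕ} [Fact p.Prime] {n : ℕ}

theorem toZMod_eq_zero_iff (x : ℤ_[p]) : PadicInt.toZMod x = 0 ↔ ‖(x : ℚ_[p])‖ < 1 := by
  rw [← RingHom.mem_ker, PadicInt.ker_toZMod, IsLocalRing.mem_maximalIdeal, PadicInt.mem_nonunits]
  rfl

theorem mem_integralUnits {x : ℚ_[p]ˣ} : x ∈ integralUnits p ↔ ‖(x : ℚ_[p])‖ = 1 := by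
  constructor
  · rintro ⟨y, rfl⟩
    exact PadicInt.norm_units y
  · intro h
    refine ⟨PadicInt.mkUnits h, Units.ext ?_⟩
    rfl

variable (p n) in
/-- Matrices with entries in `ℤ_p`. -/
def integralMatrices : Submonoid (Matrix (Fin n) (Fin n) ℚ_[p]) where
  carrier := {M | ∀ i j, ‖M i j‖ ≤ 1}
  mul_mem' {a b} ha hb i j := by
    rw [Matrix.mul_apply]
    refine Finset.sum_induction _ (fun x : ℚ_[p] => ‖x‖ ≤ 1) ?_ ?_ ?_
    · intro x y hx hy
      exact (Padic.nonarchimedean _ _).trans (max_le hx hy)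
    · simp
    · intro k _
      rw [norm_mul]
      exact mul_le_one₀ (ha i k) (norm_nonneg _) (hb k j)
  one_mem' i j := by
    rw [Matrix.one_apply]
    split <;> simp

variable (p n) in
/-- `GL_n(ℤ_p)` inside `GL_n(ℚ_p)`. -/
def integralGL : Subgroup (GL (Fin n) ℚ_[p]) := (integralMatrices p n).units

theorem mem_integralGL {g : GL (Fin n) ℚ_[p]} :
    g ∈ integralGL p n ↔ (∀ i j, ‖g i j‖ ≤ 1) ∧ ∀ i j, ‖g⁻¹ i j‖ ≤ 1 :=
  Submonoid.mem_units_iff _ _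

theorem mem_iwahori {g : GL (Fin n) ℚ_[p]} :
    g ∈ iwahori p n ↔ g ∈ integralGL p n ∧ ∀ i j, j < i → ‖g i j‖ < 1 := by
  constructor
  · rintro ⟨h, hh, rfl⟩
    refine ⟨mem_integralGL.mpr ⟨fun i j => (h i j).2, fun i j => ?_⟩, fun i j hij => ?_⟩
    · rw [← map_inv]
      exact (h⁻¹ i j).2
    · exact (toZMod_eq_zero_iff _).mp (hh i j hij)
  · rintro ⟨hg, hlow⟩
    rw [mem_integralGL] at hg
    let A : Matrix (Fin n) (Fin n) ℤ_[p] := Matrix.of fun i j => ⟨g i j, hg.1 i j⟩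
    let B : Matrix (Fin n) (Fin n) ℤ_[p] := Matrix.of fun i j => ⟨g⁻¹ i j, hg.2 i j⟩
    have hA : A.map (PadicInt.Coe.ringHom (p := p)) = g := by ext i j; rfl
    have hB : B.map (PadicInt.Coe.ringHom (p := p)) = (g⁻¹ : GL (Fin n) ℚ_[p]) := by
      ext i j; rfl
    -- The relations `g g⁻¹ = g⁻¹ g = 1` descend to `ℤ_p` because its matrices embed into those over
    -- `ℚ_p`.
    have hinj : Function.Injective
        (fun M : Matrix (Fin n) (Fin n) ℤ_[p] => M.map (PadicInt.Coe.ringHom (p := p))) :=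
      Matrix.map_injective Subtype.coe_injective
    have hAB : A * B = 1 := hinj <| by
      simp only [Matrix.map_mul, hA, hB]
      simp
    have hBA : B * A = 1 := hinj <| by
      simp only [Matrix.map_mul, hA, hB]
      simp
    refine ⟨⟨A, B, hAB, hBA⟩, fun i j hij => ?_, Units.ext hA⟩
    exact (toZMod_eq_zero_iff _).mpr (hlow i j hij)

theorem norm_sum_lt_one {ι : Type*} {s : Finset ι} {f : ι → ℚ_[p]} (h : ∀ i ∈ s, ‖f i‖ < 1) :
    ‖∑ i ∈ s, f i‖ < 1 := by
  refine Finset.sum_induction _ (fun x : ℚ_[p] => ‖x‖ < 1) ?_ ?_ h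
  · intro x y hx hy
    exact (Padic.nonarchimedean _ _).trans_lt (max_lt hx hy)
  · simp

theorem norm_mul_lt_one_left {x y : ℚ_[p]} (hx : ‖x‖ < 1) (hy : ‖y‖ ≤ 1) : ‖x * y‖ < 1 := by
  rw [norm_mul]
  exact mul_lt_one_of_nonneg_of_lt_one_left (norm_nonneg _) hx hy

theorem norm_mul_lt_one_right {x y : ℚ_[p]} (hx : ‖x‖ ≤ 1) (hy : ‖y‖ < 1) : ‖x * y‖ < 1 := by
  rw [mul_comm]
  exact norm_mul_lt_one_left hy hx

/-- If `g i i` were not a unit, every term of `1 = ∑ g i k * g⁻¹ k i` would have norm below 1: for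
`k < i` because of `g`, for `k > i` because of `g⁻¹`. The diagonal entries thus serve as pivots in
all eliminations below. -/
theorem norm_diag_of_mem_iwahori {g : GL (Fin n) ℚ_[p]} (hg : g ∈ iwahori p n) (i : Fin n) :
    ‖g i i‖ = 1 := by
  have hg' := mem_iwahori.mp ((iwahori p n).inv_mem hg)
  rw [mem_iwahori] at hg
  refine le_antisymm ((mem_integralGL.mp hg.1).1 i i) (not_lt.mp fun hlt => ?_)
  have h1 : (g * g⁻¹) i i = 1 := by simp
  rw [Units.val_mul, Matrix.mul_apply] at h1
  have h2 : ‖∑ k, g i k * g⁻¹ k i‖ < 1 := by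
    refine norm_sum_lt_one fun k _ => ?_
    rcases lt_trichotomy k i with hk | rfl | hk
    · exact norm_mul_lt_one_left (hg.2 i k hk) ((mem_integralGL.mp hg'.1).1 k i)
    · exact norm_mul_lt_one_left hlt ((mem_integralGL.mp hg'.1).1 k k)
    · exact norm_mul_lt_one_right ((mem_integralGL.mp hg.1).1 i k) (hg'.2 k i hk)
  rw [h1, norm_one] at h2
  exact lt_irrefl _ h2

theorem colUnip_mem_integralGL {k : Fin n} {c : Fin n → ℚ_[p]} (hc : c k = 0)
    (h : ∀ i, ‖c i‖ ≤ 1) : colUnip k c hc ∈ integralGL p n := by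
  have key : ∀ (c : Fin n → ℚ_[p]) (hc : c k = 0), (∀ i, ‖c i‖ ≤ 1) →
      ∀ i j, ‖colUnip k c hc i j‖ ≤ 1 := by
    intro c hc h i j
    rw [colUnip_apply]
    refine (Padic.nonarchimedean _ _).trans (max_le ?_ ?_)
    · rw [Matrix.one_apply]; split <;> simp
    · split
      · exact h i
      · simp
  refine mem_integralGL.mpr ⟨key c hc h, ?_⟩
  rw [colUnip_inv]
  exact key _ _ fun i => by simpa using h i

theorem colUnip_mem_iwahori {k : Fin n} {c : Fin n → ℚ_[p]} (hc : c k = 0)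
    (h : ∀ i, ‖c i‖ ≤ 1) (h' : ∀ i, k < i → ‖c i‖ < 1) : colUnip k c hc ∈ iwahori p n := by
  refine mem_iwahori.mpr ⟨colUnip_mem_integralGL hc h, fun i j hij => ?_⟩
  rw [colUnip_apply, Matrix.one_apply_ne hij.ne', zero_add]
  split
  · subst_vars
    exact h' i hij
  · simp

theorem permGL_mem_integralGL (σ : Equiv.Perm (Fin n)) : permGL σ ∈ integralGL p n := by
  have key : ∀ (σ : Equiv.Perm (Fin n)) i j, ‖(permGL σ : GL (Fin n) ℚ_[p]) i j‖ ≤ 1 := by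
    intro σ i j
    simp only [permGL, Matrix.of_apply]
    split <;> simp
  refine mem_integralGL.mpr ⟨key σ, ?_⟩
  rw [permGL_inv]
  exact key _

/-! ### Topology -/

theorem isOpen_norm_le_one : IsOpen {x : ℚ_[p] | ‖x‖ ≤ 1} := by
  have := IsUltrametricDist.isOpen_closedBall (0 : ℚ_[p]) one_ne_zero
  simpa [Metric.closedBall] using this

theorem isCompact_norm_le_one : IsCompact {x : ℚ_[p] | ‖x‖ ≤ 1} := by
  have := isCompact_closedBall (0 : ℚ_[p]) 1
  simpa [Metric.closedBall] using this

variable (p n) in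
theorem isOpen_iwahori : IsOpen (iwahori p n : Set (GL (Fin n) ℚ_[p])) := by
  have h : (iwahori p n : Set (GL (Fin n) ℚ_[p])) =
      (⋂ i, ⋂ j, {g | ‖g i j‖ ≤ 1}) ∩ (⋂ i, ⋂ j, {g | ‖g⁻¹ i j‖ ≤ 1}) ∩
        ⋂ i, ⋂ j, ⋂ (_ : j < i), {g | ‖g i j‖ < 1} := by
    ext g
    simp only [SetLike.mem_coe, mem_iwahori, mem_integralGL, Set.mem_inter_iff, Set.mem_iInter,
      Set.mem_ofPred_eq]
  have hc : ∀ i j, Continuous fun g : GL (Fin n) ℚ_[p] => g i j := fun i j =>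
    Units.continuous_val.matrix_elem i j
  have hc' : ∀ i j, Continuous fun g : GL (Fin n) ℚ_[p] => g⁻¹ i j := fun i j =>
    Units.continuous_coe_inv.matrix_elem i j
  rw [h]
  refine ((isOpen_iInter_of_finite fun i => isOpen_iInter_of_finite fun j => ?_).inter
    (isOpen_iInter_of_finite fun i => isOpen_iInter_of_finite fun j => ?_)).inter
    (isOpen_iInter_of_finite fun i => isOpen_iInter_of_finite fun j =>
      isOpen_iInter_of_finite fun _ => ?_)
  · exact isOpen_norm_le_one.preimage (hc i j)
  · exact isOpen_norm_le_one.preimage (hc' i j)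
  · exact isOpen_lt (hc i j).norm continuous_const

variable (p n) in
theorem isCompact_iwahori : IsCompact (iwahori p n : Set (GL (Fin n) ℚ_[p])) := by
  have h1 : IsCompact (integralMatrices p n : Set (Matrix (Fin n) (Fin n) ℚ_[p])) := by
    have := isCompact_univ_pi (X := fun _ : Fin n => Fin n → ℚ_[p])
      (s := fun _ => Set.univ.pi fun _ => {x | ‖x‖ ≤ 1})
      fun _ => isCompact_univ_pi fun _ => isCompact_norm_le_one
    have h2 : (integralMatrices p n : Set (Matrix (Fin n) (Fin n) ℚ_[p])) =
        Set.univ.pi fun _ => Set.univ.pi fun _ => {x | ‖x‖ ≤ 1} := by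
      exact Set.ext fun M => ⟨fun h i _ j _ => h i j, fun h i j => h i trivial j trivial⟩
    rw [h2]
    exact this
  have h2 : IsCompact (integralGL p n : Set (GL (Fin n) ℚ_[p])) :=
    Submonoid.units_isCompact h1
  exact h2.of_isClosed_subset ((iwahori p n).isClosed_of_isOpen (isOpen_iwahori p n))
    fun g hg => (mem_iwahori.mp hg).1

variable (p) in
theorem isOpen_integralUnits : IsOpen (integralUnits p : Set ℚ_[p]ˣ) := by
  have h : (integralUnits p : Set ℚ_[p]ˣ) =
      {x : ℚ_[p]ˣ | ‖(x : ℚ_[p])‖ ≤ 1} ∩ {x : ℚ_[p]ˣ | ‖((x⁻¹ : ℚ_[p]ˣ) : ℚ_[p])‖ ≤ 1} := by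
    ext x
    have hx : 0 < ‖(x : ℚ_[p])‖ := norm_pos_iff.mpr x.ne_zero
    simp only [SetLike.mem_coe, mem_integralUnits, Set.mem_inter_iff, Set.mem_ofPred_eq,
      Units.val_inv_eq_inv_val, norm_inv, inv_le_one₀ hx]
    exact ⟨fun h => ⟨h.le, h.ge⟩, fun h => le_antisymm h.1 h.2⟩
  rw [h]
  exact (isOpen_norm_le_one.preimage Units.continuous_val).inter
    (isOpen_norm_le_one.preimage Units.continuous_coe_inv)

variable (p) in
theorem isCompact_integralUnits : IsCompact (integralUnits p : Set ℚ_[p]ˣ) := by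
  let S : Submonoid ℚ_[p] :=
    { carrier := {x | ‖x‖ ≤ 1}
      mul_mem' := fun {x y} hx hy =>
        (norm_mul x y).trans_le (mul_le_one₀ hx (norm_nonneg _) hy)
      one_mem' := norm_one.le }
  have h : IsCompact (S.units : Set ℚ_[p]ˣ) := Submonoid.units_isCompact isCompact_norm_le_one
  refine h.of_isClosed_subset ((integralUnits p).isClosed_of_isOpen (isOpen_integralUnits p))
    fun x hx => (Submonoid.mem_units_iff _ _).mpr ⟨(mem_integralUnits.mp hx).le, ?_⟩
  exact (mem_integralUnits.mp ((integralUnits p).inv_mem hx)).le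

variable (p n) in
theorem isOpen_Iw : IsOpen (Iw p n : Set (GG p n)) := by
  rw [Iw, Subgroup.coe_prod]
  exact (isOpen_iwahori p n).prod (isOpen_integralUnits p)

variable (p n) in
theorem isCompact_Iw : IsCompact (Iw p n : Set (GG p n)) := by
  rw [Iw, Subgroup.coe_prod]
  exact (isCompact_iwahori p n).prod (isCompact_integralUnits p)

theorem relIndex_ne_zero_of_isOpen_of_isCompact {G : Type*} [Group G] [TopologicalSpace G]
    [IsTopologicalGroup G] {S K : Subgroup G} (hS : IsOpen (S : Set G))
    (hK : IsCompact (K : Set G)) : S.relIndex K ≠ 0 := by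
  have : CompactSpace K := isCompact_iff_compactSpace.mp hK
  have : Finite (K ⧸ S.subgroupOf K) :=
    Subgroup.quotient_finite_of_isOpen _ (hS.preimage continuous_subtype_val)
  exact (Subgroup.finiteIndex_of_finite_quotient (H := S.subgroupOf K)).index_ne_zero

theorem isOpen_conjSubgroup {G : Type*} [Group G] [TopologicalSpace G]
    [IsTopologicalGroup G] {H : Subgroup G} (hH : IsOpen (H : Set G)) (g : G) :
    IsOpen (conjSubgroup g H : Set G) := by
  have h : (conjSubgroup g H : Set G) = (fun x => g⁻¹ * x * g) ⁻¹' H := by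
    ext x
    exact mem_conjSubgroup
  rw [h]
  exact hH.preimage (by fun_prop)

theorem IsSmooth.isLocallyFinite {E G V : Type*} [Field E] [Group G] [AddCommGroup V] [Module E V]
    [TopologicalSpace G] [IsTopologicalGroup G] {ρ : Representation E G V} (h : IsSmooth ρ)
    {K : Subgroup G} (hK : IsCompact (K : Set G)) : IsLocallyFinite ρ K := fun v => by
  obtain ⟨S, hS, hv⟩ := h v
  exact ⟨S, relIndex_ne_zero_of_isOpen_of_isCompact hS hK, hv⟩

theorem relIndex_conj_ne_zero {G : Type*} [Group G] [TopologicalSpace G]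
    [IsTopologicalGroup G] {H : Subgroup G} (hH : IsOpen (H : Set G))
    (hH' : IsCompact (H : Set G)) (g : G) : (conjSubgroup g H).relIndex H ≠ 0 :=
  relIndex_ne_zero_of_isOpen_of_isCompact (isOpen_conjSubgroup hH g) hH'

end Iwahori

/-! ### Triangular factorisations of the Iwahori subgroup -/

section Factor

variable {p : ℕ} [Fact p.Prime] {n : ℕ}

/-- Gaussian elimination above the diagonal, one column at a time from the right; `k` counts the
cleared columns. The pivots are units, so the row operations stay integral. -/
theorem exists_upper_mul_lower_of_le {g : GL (Fin n) ℚ_[p]} (hg : g ∈ iwahori p n) (k : ℕ) :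
    ∃ b ∈ iwahori p n ⊓ upperBorel n ℚ_[p],
      ∀ i j : Fin n, i < j → n ≤ j + k → (b * g) i j = 0 := by
  induction k with
  | zero => exact ⟨1, Subgroup.one_mem _, fun i j _ h => absurd j.2 (by omega)⟩
  | succ k ih =>
    obtain ⟨b, hb, hbg⟩ := ih
    by_cases hk : n ≤ k
    · exact ⟨b, hb, fun i j hij _ => hbg i j hij (by omega)⟩
    let κ : Fin n := ⟨n - k - 1, by omega⟩
    have hI := (iwahori p n).mul_mem hb.1 hg
    set h := b * g with hh
    have hd := norm_diag_of_mem_iwahori hI κ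
    have hd0 : h κ κ ≠ 0 := fun h0 => by rw [h0, norm_zero] at hd; exact zero_ne_one hd
    let c : Fin n → ℚ_[p] := fun i => if i < κ then -(h i κ / h κ κ) else 0
    have hc : c κ = 0 := if_neg (lt_irrefl _)
    refine ⟨colUnip κ c hc * b, Subgroup.mul_mem _ ⟨colUnip_mem_iwahori hc ?_ ?_, ?_⟩ hb, ?_⟩
    · intro i
      simp only [c]
      split
      · rw [norm_neg, norm_div, hd, div_one]
        exact (mem_integralGL.mp (mem_iwahori.mp hI).1).1 i κ
      · simp
    · intro i hi
      simp [c, hi.not_gt]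
    · intro i j hij
      rw [colUnip_apply, Matrix.one_apply_ne hij.ne', zero_add]
      split
      · subst_vars
        simp [c, hij.not_gt]
      · rfl
    · intro i j hij hj
      rw [mul_assoc, ← hh, colUnip_mul_apply]
      -- Row `κ` already vanishes to the right of the pivot, so adding multiples of it leaves the
      -- cleared columns alone; in column `κ` the choice of `c` gives zero.
      by_cases hjk : n ≤ j + k
      · have hκj : κ < j := by
          rw [Fin.lt_def]
          change n - k - 1 < (j : ℕ)
          omega
        rw [hbg i j hij hjk, hbg κ j hκj hjk, mul_zero, add_zero]
      · have : j = κ := Fin.ext (by change (j : ℕ) = n - k - 1; omega)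
        subst this
        simp only [c, if_pos hij]
        field_simp
        ring

theorem exists_upper_mul_lower {g : GL (Fin n) ℚ_[p]} (hg : g ∈ iwahori p n) :
    ∃ b ∈ iwahori p n ⊓ upperBorel n ℚ_[p], ∀ i j : Fin n, i < j → (b * g) i j = 0 := by
  obtain ⟨b, hb, h⟩ := exists_upper_mul_lower_of_le hg n
  exact ⟨b, hb, fun i j hij => h i j hij (by omega)⟩

theorem inv_lower {g : GL (Fin n) ℚ_[p]} (hg : ∀ i j : Fin n, i < j → g i j = 0) :
    ∀ i j : Fin n, i < j → g⁻¹ i j = 0 := by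
  have := Units.invertible g
  have h := Matrix.blockTriangular_inv_of_blockTriangular
    (M := (g : Matrix (Fin n) (Fin n) ℚ_[p])) (b := OrderDual.toDual) (fun i j h => hg i j h)
  intro i j hij
  have h2 := h (OrderDual.toDual_lt_toDual.mpr hij)
  rwa [← Matrix.coe_units_inv] at h2

/-- Every element of the Iwahori subgroup is a product of an element whose first column is a
multiple of the first basis vector and a unipotent element supported on the first column. -/
theorem exists_parabolic_mul_colUnip {m : ℕ} {g : GL (Fin (m + 1)) ℚ_[p]}
    (hg : g ∈ iwahori p (m + 1)) :
    ∃ (c : Fin (m + 1) → ℚ_[p]) (hc : c 0 = 0), (∀ i, ‖c i‖ ≤ 1) ∧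
      ∃ k ∈ iwahori p (m + 1), (∀ i : Fin m, k i.succ 0 = 0) ∧ g = k * colUnip 0 c hc := by
  -- The first column of `g⁻¹`, not of `g`, is cleared from the left, so that after inversion the
  -- unipotent factor stands on the right.
  have hI := (iwahori p (m + 1)).inv_mem hg
  set h := g⁻¹ with hh
  have hd := norm_diag_of_mem_iwahori hI 0
  have hd0 : h 0 0 ≠ 0 := fun h0 => by rw [h0, norm_zero] at hd; exact zero_ne_one hd
  let c : Fin (m + 1) → ℚ_[p] := Fin.cons 0 fun i => -(h i.succ 0 / h 0 0)
  have hc : c 0 = 0 := rfl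
  have hc1 : ∀ i, 0 < i → ‖c i‖ < 1 := by
    intro i
    refine Fin.cases (fun h => absurd h (lt_irrefl _)) (fun i _ => ?_) i
    simp only [c, Fin.cons_succ]
    rw [norm_neg, norm_div, hd, div_one]
    exact (mem_iwahori.mp hI).2 _ _ (Fin.succ_pos i)
  have hc2 : ∀ i, ‖c i‖ ≤ 1 := by
    intro i
    rcases (Fin.zero_le i).eq_or_lt with rfl | hi
    · simp [hc]
    · exact (hc1 i hi).le
  let P := parabolic p m
  have hP : (colUnip 0 c hc * h, (1 : ℚ_[p]ˣ)) ∈ P := by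
    intro i
    rw [colUnip_mul_apply]
    simp only [c, Fin.cons_succ]
    field_simp
    ring
  refine ⟨c, hc, hc2, (colUnip 0 c hc * h)⁻¹, (iwahori p (m + 1)).inv_mem
    ((iwahori p (m + 1)).mul_mem (colUnip_mem_iwahori hc hc2 hc1) hI), P.inv_mem hP, ?_⟩
  rw [hh]
  simp

/-- Conjugation scales the entry at `(i, j)` by `p ^ (a j - a i)`, which is integral wherever the
entry matters. For antitone `a` this serves lower triangular matrices, and with `-a` upper
triangular ones. -/
theorem diagPow_inv_conj_mem {a : Fin n → ℤ} {g : GL (Fin n) ℚ_[p]} (hg : g ∈ iwahori p n)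
    (h : ∀ i j, i ≠ j → g i j ≠ 0 → a i ≤ a j) (h' : ∀ i j, i ≠ j → g⁻¹ i j ≠ 0 → a i ≤ a j) :
    (diagPow p a)⁻¹ * g * diagPow p a ∈ iwahori p n := by
  have key : ∀ (x : ℚ_[p]) i j, (i ≠ j → x ≠ 0 → a i ≤ a j) →
      ‖(p : ℚ_[p]) ^ (a j - a i) * x‖ ≤ ‖x‖ := by
    intro x i j hx
    by_cases h0 : x = 0
    · simp [h0]
    by_cases hij : i = j
    · simp [hij]
    · rw [norm_mul]
      exact mul_le_of_le_one_left (norm_nonneg _)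
        (norm_p_zpow_le_one p (by linarith [hx hij h0]))
  have hg' := mem_iwahori.mp hg
  have hg2 := mem_integralGL.mp hg'.1
  refine mem_iwahori.mpr ⟨mem_integralGL.mpr ⟨fun i j => ?_, fun i j => ?_⟩, fun i j hij => ?_⟩
  · rw [diagPow_inv_conj_apply]
    exact (key _ i j (h i j)).trans (hg2.1 i j)
  · have : ((diagPow p a)⁻¹ * g * diagPow p a)⁻¹ = (diagPow p a)⁻¹ * g⁻¹ * diagPow p a := by
      group
    rw [this, diagPow_inv_conj_apply]
    exact (key _ i j (h' i j)).trans (hg2.2 i j)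
  · rw [diagPow_inv_conj_apply]
    exact (key _ i j (h i j)).trans_lt (hg'.2 i j hij)

theorem diagPow_mem_upperBorel (a : Fin n → ℤ) : diagPow p a ∈ upperBorel n ℚ_[p] := by
  intro i j hij
  rw [diagPow_coe, Matrix.diagonal_apply_ne _ hij.ne']

end Factor

/-! ### Positivity of dominant torus elements -/

section Positive

variable {p : ℕ} [Fact p.Prime] {n : ℕ}

variable (p n) in
/-- The upper triangular elements of `Iw_p`. -/
def borelIw : Subgroup (GG p n) :=
  Iw p n ⊓ (upperBorel n ℚ_[p]).comap (MonoidHom.fst _ _)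

theorem mem_Iw {x : GG p n} : x ∈ Iw p n ↔ x.1 ∈ iwahori p n ∧ x.2 ∈ integralUnits p :=
  Subgroup.mem_prod

theorem borelIw_le : borelIw p n ≤ Iw p n := inf_le_left

theorem torusElt_conj (u : Uminus n) (x : GG p n) :
    (torusElt p u)⁻¹ * x * torusElt p u =
      ((diagPow p (Multiplicative.toAdd u).1.1)⁻¹ * x.1 *
        diagPow p (Multiplicative.toAdd u).1.1, x.2) := by
  refine Prod.ext rfl ?_
  simp only [Prod.snd_mul, Prod.snd_inv]
  rw [mul_comm, mul_inv_cancel_left]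

/-- Write `x = b⁻¹ l` with `b` upper and `l` lower triangular, both Iwahori in the matrix component:
`t⁻¹` contracts `l`, which gives the factorisation. The intersection is `t B₀ t⁻¹` because `t` is
itself triangular and contracts the upper triangular group `B₀`. -/
theorem isPositive_torusElt (u : Uminus n) :
    IsPositive (Iw p n) (borelIw p n) (torusElt p u) where
  factor x hx := by
    have hu : Antitone (Multiplicative.toAdd u).1.1 := (Multiplicative.toAdd u).2
    obtain ⟨b, hb, hlow⟩ := exists_upper_mul_lower (mem_Iw.mp hx).1
    refine ⟨(b⁻¹, 1), ⟨mem_Iw.mpr ⟨(iwahori p n).inv_mem hb.1, Subgroup.one_mem _⟩,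
      (upperBorel n ℚ_[p]).inv_mem hb.2⟩, ?_⟩
    rw [mem_conjSubgroup, torusElt_conj, mem_Iw]
    have hx2 : ((b⁻¹, 1)⁻¹ * x : GG p n) = (b * x.1, x.2) := by
      refine Prod.ext ?_ ?_ <;> simp
    rw [hx2]
    have aux : ∀ g : GL (Fin n) ℚ_[p], (∀ i j : Fin n, i < j → g i j = 0) → ∀ i j, i ≠ j →
        g i j ≠ 0 → (Multiplicative.toAdd u).1.1 i ≤ (Multiplicative.toAdd u).1.1 j := by
      intro g hg i j hij h0
      rcases lt_or_gt_of_ne hij with h | h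
      · exact absurd (hg i j h) h0
      · exact hu h.le
    exact ⟨diagPow_inv_conj_mem ((iwahori p n).mul_mem hb.1 (mem_Iw.mp hx).1) (aux _ hlow)
      (aux _ (inv_lower hlow)), (mem_Iw.mp hx).2⟩
  inter := by
    have hu : Antitone (Multiplicative.toAdd u).1.1 := (Multiplicative.toAdd u).2
    have hd : diagPow p (Multiplicative.toAdd u).1.1 ∈ upperBorel n ℚ_[p] :=
      diagPow_mem_upperBorel _
    ext x
    rw [Subgroup.mem_inf, mem_conjSubgroup, mem_conjSubgroup, torusElt_conj]
    constructor
    · rintro ⟨h1, h2⟩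
      exact ⟨h1, (upperBorel n ℚ_[p]).mul_mem ((upperBorel n ℚ_[p]).mul_mem
        ((upperBorel n ℚ_[p]).inv_mem hd) h2.2) hd⟩
    · rintro ⟨h1, h2⟩
      refine ⟨h1, ?_⟩
      set y := (diagPow p (Multiplicative.toAdd u).1.1)⁻¹ * x.1 *
        diagPow p (Multiplicative.toAdd u).1.1 with hy
      have h2' : y ∈ upperBorel n ℚ_[p] := h2
      have hx : x.1 = (diagPow p (-(Multiplicative.toAdd u).1.1))⁻¹ * y *
          diagPow p (-(Multiplicative.toAdd u).1.1) := by
        rw [← diagPow_inv, hy]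
        group
      have aux : ∀ g ∈ upperBorel n ℚ_[p], ∀ i j, i ≠ j →
          g i j ≠ 0 → (-(Multiplicative.toAdd u).1.1) i ≤ (-(Multiplicative.toAdd u).1.1) j := by
        intro g hg i j hij h0
        rcases lt_or_gt_of_ne hij with h | h
        · exact neg_le_neg (hu h.le)
        · exact absurd (hg i j h) h0
      refine ⟨mem_Iw.mpr ⟨?_, h1.2⟩, ?_⟩
      · rw [hx]
        exact diagPow_inv_conj_mem (mem_Iw.mp h1).1 (aux _ h2')
          (aux _ ((upperBorel n ℚ_[p]).inv_mem h2'))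
      · change x.1 ∈ upperBorel n ℚ_[p]
        rw [hx]
        exact (upperBorel n ℚ_[p]).mul_mem ((upperBorel n ℚ_[p]).mul_mem
          ((upperBorel n ℚ_[p]).inv_mem (diagPow_mem_upperBorel _)) h2')
          (diagPow_mem_upperBorel _)
  finite := relIndex_conj_ne_zero (isOpen_Iw p n) (isCompact_Iw p n) _

theorem torusElt_mul (u u' : Uminus n) : torusElt p (u * u') = torusElt p u * torusElt p u' :=
  Prod.ext (diagPow_add p _ _) (zpow_add _ _ _)

theorem torusElt_one : torusElt p (1 : Uminus n) = 1 :=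
  Prod.ext (diagPow_zero p) (zpow_zero _)

end Positive

/-! ### The action of `U⁻` on Iwahori invariants. -/

section HeckeRep

variable {E G V : Type*} [Field E] [Group G] [AddCommGroup V] [Module E V]
variable {ρ : Representation E G V}

theorem heckeOperator_one [CharZero E] {H : Subgroup G} (hlf : IsLocallyFinite ρ H) :
    heckeOperator ρ H 1 = 1 := by
  have h1 : (conjSubgroup 1 H).relIndex H = 1 := by
    have : conjSubgroup 1 H = H := by ext; simp [mem_conjSubgroup]
    rw [this, Subgroup.relIndex_self]
  refine LinearMap.ext fun v => Subtype.ext ?_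
  refine fixed_eq_of_sub_mem hlf (Subtype.coe_prop _) (Subtype.coe_prop _) ?_
  simpa [h1] using heckeOperator_sub_mem_self (g := 1) (by rw [h1]; exact one_ne_zero) v

variable {p : ℕ} [Fact p.Prime] {n : ℕ} {π : Representation E (GG p n) V}

variable (π) in
/-- The action of `U⁻` on `π^{Iw_p}` by Hecke operators. -/
def heckeRep [CharZero E] (hπ : IsSmooth π) : Representation E (Uminus n) (fixedBy π (Iw p n)) where
  toFun u := heckeOperator π (Iw p n) (torusElt p u)
  map_one' := by
    rw [torusElt_one, heckeOperator_one (hπ.isLocallyFinite (isCompact_Iw p n))]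
  map_mul' u u' := by
    have h := isPositive_torusElt (p := p) (u * u')
    rw [torusElt_mul] at h ⊢
    exact heckeOperator_mul (hπ.isLocallyFinite (isCompact_Iw p n)) borelIw_le
      (isPositive_torusElt u) (isPositive_torusElt u') h

end HeckeRep

/-! ### The Levi subgroup and the Iwahori subgroup -/

section Levi

variable {p : ℕ} [Fact p.Prime] {m : ℕ}

theorem leviEmb_zero_zero (l : Levi p m) : (leviEmb p m l).1.1 0 0 = l.1 := rfl

theorem leviEmb_zero_succ (l : Levi p m) (j : Fin m) : (leviEmb p m l).1.1 0 j.succ = 0 := rfl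

theorem leviEmb_succ_zero (l : Levi p m) (i : Fin m) : (leviEmb p m l).1.1 i.succ 0 = 0 := rfl

theorem leviEmb_succ_succ (l : Levi p m) (i j : Fin m) :
    (leviEmb p m l).1.1 i.succ j.succ = l.2.1 i j := rfl

theorem leviProj_leviEmb (l : Levi p m) : leviProj p m (leviEmb p m l) = l :=
  Prod.ext (Units.ext rfl) (Prod.ext (Units.ext (Matrix.ext fun _ _ => rfl)) rfl)

theorem mem_IwIg {l : Levi p m} : l ∈ IwIg p m ↔
    l.1 ∈ integralUnits p ∧ l.2.1 ∈ iwahori p m ∧ l.2.2 ∈ integralUnits p := by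
  rw [IwIg, Subgroup.mem_prod, Subgroup.mem_prod]

theorem coe_leviEmb_torusEltLevi (u : Uminus (m + 1)) :
    (leviEmb p m (torusEltLevi p m u) : GG p (m + 1)) = torusElt p u := by
  refine Prod.ext (Units.ext (Matrix.ext fun i j => ?_)) rfl
  change _ = (diagPow p (Multiplicative.toAdd u).1.1 :
    Matrix (Fin (m + 1)) (Fin (m + 1)) ℚ_[p]) i j
  rw [diagPow_coe]
  refine Fin.cases ?_ (fun i => ?_) i <;> refine Fin.cases ?_ (fun j => ?_) j
  · rw [leviEmb_zero_zero, Matrix.diagonal_apply_eq]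
    simp [torusEltLevi, pUnit]
  · rw [leviEmb_zero_succ, Matrix.diagonal_apply_ne _ (Fin.succ_ne_zero j).symm]
  · rw [leviEmb_succ_zero, Matrix.diagonal_apply_ne _ (Fin.succ_ne_zero i)]
  · rw [leviEmb_succ_succ]
    change (diagPow p (fun i : Fin m => (Multiplicative.toAdd u).1.1 i.succ) :
      Matrix (Fin m) (Fin m) ℚ_[p]) i j = _
    rw [diagPow_coe]
    simp [Matrix.diagonal_apply]

theorem leviEmb_mem_Iw {l : Levi p m} (hl : l ∈ IwIg p m) :
    (leviEmb p m l : GG p (m + 1)) ∈ Iw p (m + 1) := by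
  have key : ∀ l ∈ IwIg p m, ∀ i j, ‖(leviEmb p m l).1.1 i j‖ ≤ 1 := by
    intro l hl i j
    rw [mem_IwIg] at hl
    refine Fin.cases ?_ (fun i => ?_) i <;> refine Fin.cases ?_ (fun j => ?_) j
    · exact (mem_integralUnits.mp hl.1).le
    · rw [leviEmb_zero_succ, norm_zero]; exact zero_le_one
    · rw [leviEmb_succ_zero, norm_zero]; exact zero_le_one
    · exact (mem_integralGL.mp (mem_iwahori.mp hl.2.1).1).1 i j
  refine mem_Iw.mpr ⟨mem_iwahori.mpr ⟨mem_integralGL.mpr ⟨key l hl, ?_⟩, ?_⟩,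
    (mem_IwIg.mp hl).2.2⟩
  · have := key l⁻¹ ((IwIg p m).inv_mem hl)
    rwa [map_inv] at this
  · intro i j
    refine Fin.cases (fun h => absurd h (Fin.not_lt_zero j)) (fun i => ?_) i
    refine Fin.cases (fun _ => ?_) (fun j hij => ?_) j
    · rw [leviEmb_succ_zero, norm_zero]; exact zero_lt_one
    · exact (mem_iwahori.mp (mem_IwIg.mp hl).2.1).2 i j (Fin.succ_lt_succ_iff.mp hij)

theorem leviProj_mem_IwIg {k : parabolic p m} (hk : (k : GG p (m + 1)) ∈ Iw p (m + 1)) :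
    leviProj p m k ∈ IwIg p m := by
  have key : ∀ k : parabolic p m, (k : GG p (m + 1)) ∈ Iw p (m + 1) →
      ∀ i j, ‖(leviProj p m k).2.1 i j‖ ≤ 1 := fun k hk i j =>
    (mem_integralGL.mp (mem_iwahori.mp (mem_Iw.mp hk).1).1).1 i.succ j.succ
  refine mem_IwIg.mpr ⟨mem_integralUnits.mpr (norm_diag_of_mem_iwahori (mem_Iw.mp hk).1 0),
    mem_iwahori.mpr ⟨mem_integralGL.mpr ⟨key k hk, ?_⟩, fun i j hij => ?_⟩, (mem_Iw.mp hk).2⟩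
  · have := key k⁻¹ ((Iw p (m + 1)).inv_mem hk)
    rwa [map_inv] at this
  · exact (mem_iwahori.mp (mem_Iw.mp hk).1).2 i.succ j.succ (Fin.succ_lt_succ_iff.mpr hij)

theorem mul_leviEmb_inv_mem (k : parabolic p m) :
    k * (leviEmb p m (leviProj p m k))⁻¹ ∈ unipotentRadical p m := by
  change _ ∈ (leviProj p m).ker
  rw [MonoidHom.mem_ker, map_mul, map_inv, leviProj_leviEmb, mul_inv_cancel]

theorem borelIw_le_parabolic : borelIw p (m + 1) ≤ parabolic p m :=
  fun _ hx i => hx.2 i.succ 0 (Fin.succ_pos i)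

end Levi

/-! ### Indices -/

section Index

variable {p : ℕ} [Fact p.Prime] {m : ℕ}

variable (p m) in
/-- The parametrisation of the integral points of the unipotent radical. -/
def unipRow : Multiplicative (Fin m → ℤ_[p]) →* parabolic p m where
  toFun x := ⟨(MonoidHom.toHomUnits
    { toFun := fun x : Multiplicative (Fin m → ℤ_[p]) =>
        (Matrix.of (Fin.cons (Fin.cons 1 fun j => ((Multiplicative.toAdd x j : ℤ_[p]) : ℚ_[p]))
          fun i => Fin.cons 0 ((1 : Matrix (Fin m) (Fin m) ℚ_[p]) i)) :
          Matrix (Fin (m + 1)) (Fin (m + 1)) ℚ_[p])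
      map_one' := by
        ext i j
        refine Fin.cases ?_ (fun i => ?_) i <;> refine Fin.cases ?_ (fun j => ?_) j <;>
          simp [Matrix.one_apply, Fin.succ_ne_zero, (Fin.succ_ne_zero _).symm]
      map_mul' := fun x y => by
        ext i j
        refine Fin.cases ?_ (fun i => ?_) i <;> refine Fin.cases ?_ (fun j => ?_) j <;>
          simp [Matrix.mul_apply, Fin.sum_univ_succ, Matrix.one_apply, add_comm] } x, 1),
    fun _ => rfl⟩
  map_one' := Subtype.ext (Prod.ext (map_one _) rfl)
  map_mul' x y := Subtype.ext (Prod.ext (map_mul _ _ _) (one_mul _).symm)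

theorem unipRow_zero_succ (x : Multiplicative (Fin m → ℤ_[p])) (j : Fin m) :
    (unipRow p m x).1.1 0 j.succ = ((Multiplicative.toAdd x j : ℤ_[p]) : ℚ_[p]) := rfl

theorem unipRow_mem (x : Multiplicative (Fin m → ℤ_[p])) :
    unipRow p m x ∈ unipotentRadical p m := by
  change _ ∈ (leviProj p m).ker
  rw [MonoidHom.mem_ker]
  exact Prod.ext (Units.ext rfl) (Prod.ext (Units.ext (Matrix.ext fun _ _ => rfl)) rfl)

theorem unipotentRadical_apply {k : parabolic p m} (hk : k ∈ unipotentRadical p m) :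
    k.1.1 0 0 = 1 ∧ (∀ i : Fin m, k.1.1 i.succ 0 = 0) ∧
      (∀ i j : Fin m, k.1.1 i.succ j.succ = (1 : Matrix (Fin m) (Fin m) ℚ_[p]) i j) ∧
      k.1.2 = 1 := by
  have hk' : leviProj p m k = 1 := hk
  refine ⟨congrArg (fun l : Levi p m => (l.1 : ℚ_[p])) hk', k.2, fun i j => ?_,
    congrArg (fun l : Levi p m => l.2.2) hk'⟩
  exact congrArg (fun l : Levi p m => l.2.1 i j) hk'

theorem mem_Iw_of_mem_unipotentRadical {k : parabolic p m} (hk : k ∈ unipotentRadical p m)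
    (h : ∀ j : Fin m, ‖k.1.1 0 j.succ‖ ≤ 1) (h' : ∀ j : Fin m, ‖k⁻¹.1.1 0 j.succ‖ ≤ 1) :
    (k : GG p (m + 1)) ∈ Iw p (m + 1) := by
  have key : ∀ k ∈ unipotentRadical p m, (∀ j : Fin m, ‖k.1.1 0 j.succ‖ ≤ 1) →
      ∀ i j, ‖k.1.1 i j‖ ≤ 1 := by
    intro k hk h i j
    obtain ⟨h0, h1, h2, -⟩ := unipotentRadical_apply hk
    refine Fin.cases ?_ (fun i => ?_) i <;> refine Fin.cases ?_ (fun j => ?_) j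
    · rw [h0, norm_one]
    · exact h j
    · rw [h1, norm_zero]; exact zero_le_one
    · rw [h2, Matrix.one_apply]; split <;> simp
  obtain ⟨h0, h1, h2, h3⟩ := unipotentRadical_apply hk
  refine mem_Iw.mpr ⟨mem_iwahori.mpr ⟨mem_integralGL.mpr ⟨key k hk h,
    key k⁻¹ ((unipotentRadical p m).inv_mem hk) h'⟩, fun i j => ?_⟩, ?_⟩
  · refine Fin.cases (fun h => absurd h (Fin.not_lt_zero j)) (fun i => ?_) i
    refine Fin.cases (fun _ => ?_) (fun j hij => ?_) j
    · rw [h1, norm_zero]; exact zero_lt_one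
    · rw [h2, Matrix.one_apply_ne (Fin.succ_lt_succ_iff.mp hij).ne', norm_zero]
      exact zero_lt_one
  · rw [h3]
    exact Subgroup.one_mem _

theorem range_unipRow :
    (unipRow p m).range = unipotentRadical p m ⊓ (Iw p (m + 1)).subgroupOf (parabolic p m) := by
  ext k
  constructor
  · rintro ⟨x, rfl⟩
    refine ⟨unipRow_mem x, mem_Iw_of_mem_unipotentRadical (unipRow_mem x) (fun j => ?_) fun j => ?_⟩
    · exact (Multiplicative.toAdd x j).2
    · rw [← map_inv]
      exact (Multiplicative.toAdd x⁻¹ j).2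
  · rintro ⟨hk, hI⟩
    obtain ⟨h0, h1, h2, h3⟩ := unipotentRadical_apply hk
    have hI' := (mem_integralGL.mp (mem_iwahori.mp (mem_Iw.mp
      (Subgroup.mem_subgroupOf.mp hI)).1).1).1
    refine ⟨Multiplicative.ofAdd fun j => ⟨k.1.1 0 j.succ, hI' 0 j.succ⟩,
      Subtype.ext (Prod.ext (Units.ext (Matrix.ext fun i j => ?_)) h3.symm)⟩
    refine Fin.cases ?_ (fun i => ?_) i <;> refine Fin.cases ?_ (fun j => ?_) j
    · exact h0.symm
    · rfl
    · exact (h1 i).symm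
    · exact (h2 i j).symm

/-- `[N₀ : t N₀ t⁻¹]`. -/
theorem relIndex_unipotent (u : Uminus (m + 1)) :
    (conjSubgroup (leviEmb p m (torusEltLevi p m u))
      ((Iw p (m + 1)).subgroupOf (parabolic p m))).relIndex
      (unipotentRadical p m ⊓ (Iw p (m + 1)).subgroupOf (parabolic p m)) =
      ∏ j : Fin m, p ^ ((Multiplicative.toAdd u).1.1 0 -
        (Multiplicative.toAdd u).1.1 j.succ).toNat := by
  have hu : Antitone (Multiplicative.toAdd u).1.1 := (Multiplicative.toAdd u).2
  set a := (Multiplicative.toAdd u).1.1 with ha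
  let k : Fin m → ℕ := fun j => (a 0 - a j.succ).toNat
  have hk : ∀ j, (k j : ℤ) = a 0 - a j.succ := fun j =>
    Int.toNat_of_nonneg (sub_nonneg.mpr (hu (Fin.zero_le _)))
  -- The row coordinates of `t N₀ t⁻¹` are those divisible by `p ^ k j`, so it is the kernel of this
  -- reduction and its index is the order of the target.
  let ψ : Multiplicative (Fin m → ℤ_[p]) →* Multiplicative (∀ j, ZMod (p ^ k j)) :=
    AddMonoidHom.toMultiplicative
      (AddMonoidHom.pi fun j => (PadicInt.toZModPow (k j)).toAddMonoidHom.comp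
        (Pi.evalAddMonoidHom _ j))
  have hψ : Function.Surjective ψ := by
    intro y
    choose x hx using fun j => ZMod.ringHom_surjective (PadicInt.toZModPow (p := p) (k j))
      (Multiplicative.toAdd y j)
    exact ⟨Multiplicative.ofAdd x, congrArg Multiplicative.ofAdd (funext hx)⟩
  have hnorm : ∀ (x : ℤ_[p]) j, ‖(p : ℚ_[p]) ^ (a j.succ - a 0) * (x : ℚ_[p])‖ ≤ 1 ↔
      PadicInt.toZModPow (k j) x = 0 := by
    intro x j
    rw [← RingHom.mem_ker, PadicInt.ker_toZModPow, ← PadicInt.norm_le_pow_iff_mem_span_pow,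
      norm_mul, norm_p_zpow, PadicInt.norm_def]
    have hp : (0 : ℝ) < (p : ℝ) ^ (k j : ℤ) :=
      zpow_pos (by exact_mod_cast (Fact.out : p.Prime).pos) _
    rw [neg_sub, ← hk, zpow_neg, mul_comm, ← le_div_iff₀ hp, one_div]
  have hker : (conjSubgroup (leviEmb p m (torusEltLevi p m u))
      ((Iw p (m + 1)).subgroupOf (parabolic p m))).comap (unipRow p m) = ψ.ker := by
    have key : ∀ (y : parabolic p m) (j : Fin m),
        ((leviEmb p m (torusEltLevi p m u))⁻¹ * y * leviEmb p m (torusEltLevi p m u)).1.1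
          0 j.succ = (p : ℚ_[p]) ^ (a j.succ - a 0) * y.1.1 0 j.succ := by
      intro y j
      have h1 : ((leviEmb p m (torusEltLevi p m u))⁻¹ * y *
          leviEmb p m (torusEltLevi p m u)).1 = (torusElt p u)⁻¹ * y.1 * torusElt p u := by
        rw [← coe_leviEmb_torusEltLevi]
        rfl
      rw [h1, torusElt_conj]
      exact diagPow_inv_conj_apply p a y.1.1 0 j.succ
    ext x
    rw [Subgroup.mem_comap, mem_conjSubgroup, Subgroup.mem_subgroupOf, MonoidHom.mem_ker]
    have hψx : ψ x = 1 ↔ ∀ j, PadicInt.toZModPow (k j) (Multiplicative.toAdd x j) = 0 :=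
      ⟨fun h j => congrFun (congrArg Multiplicative.toAdd h) j,
        fun h => congrArg Multiplicative.ofAdd (funext h)⟩
    rw [hψx]
    constructor
    · intro h j
      rw [← hnorm, ← unipRow_zero_succ, ← key]
      exact (mem_integralGL.mp (mem_iwahori.mp (mem_Iw.mp h).1).1).1 0 j.succ
    · intro h
      refine mem_Iw_of_mem_unipotentRadical ?_ (fun j => ?_) fun j => ?_
      · have := (inferInstance : (unipotentRadical p m).Normal).conj_mem _ (unipRow_mem x)
          (leviEmb p m (torusEltLevi p m u))⁻¹
        simpa using this
      · rw [key, unipRow_zero_succ, hnorm]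
        exact h j
      · have hinv : ((leviEmb p m (torusEltLevi p m u))⁻¹ * unipRow p m x *
            leviEmb p m (torusEltLevi p m u))⁻¹ = (leviEmb p m (torusEltLevi p m u))⁻¹ *
            unipRow p m x⁻¹ * leviEmb p m (torusEltLevi p m u) := by
          rw [map_inv]
          group
        rw [hinv, key, unipRow_zero_succ, hnorm]
        change PadicInt.toZModPow (k j) (-Multiplicative.toAdd x j) = 0
        rw [map_neg, h j, neg_zero]
  rw [← range_unipRow, MonoidHom.range_eq_map, ← Subgroup.relIndex_comap, hker,
    Subgroup.relIndex_top_right, Subgroup.index_ker, MonoidHom.range_eq_top.mpr hψ]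
  have hcard : Nat.card (⊤ : Subgroup (Multiplicative (∀ j, ZMod (p ^ k j)))) =
      Nat.card (∀ j, ZMod (p ^ k j)) := Nat.card_congr
    (Subgroup.topEquiv.toEquiv.trans Multiplicative.toAdd)
  rw [hcard, Nat.card_pi]
  exact Finset.prod_congr rfl fun j _ => Nat.card_zmod _

theorem map_leviProj_Iw :
    ((Iw p (m + 1)).subgroupOf (parabolic p m)).map (leviProj p m) = IwIg p m := by
  ext l
  constructor
  · rintro ⟨k, hk, rfl⟩
    exact leviProj_mem_IwIg hk
  · intro hl
    exact ⟨leviEmb p m l, leviEmb_mem_Iw hl, leviProj_leviEmb l⟩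

/-- Comparison of the indices attached to a dominant torus element in the group and in its Levi
subgroup. -/
theorem relIndex_Iw_eq (u : Uminus (m + 1)) :
    (conjSubgroup (torusElt p u) (Iw p (m + 1))).relIndex (Iw p (m + 1)) =
      (∏ j : Fin m, p ^ ((Multiplicative.toAdd u).1.1 0 -
        (Multiplicative.toAdd u).1.1 j.succ).toNat) *
      (conjSubgroup (torusEltLevi p m u) (IwIg p m)).relIndex (IwIg p m) := by
  set t := torusEltLevi p m u with ht
  set T := leviEmb p m t with hT
  have hTt : (T : GG p (m + 1)) = torusElt p u := coe_leviEmb_torusEltLevi u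
  set I := (Iw p (m + 1)).subgroupOf (parabolic p m) with hI
  -- The representatives in the factorisation of `Iw_p` are upper triangular, so the index can be
  -- computed inside `P`.
  have h1 : (conjSubgroup (torusElt p u) (Iw p (m + 1))).relIndex (Iw p (m + 1)) =
      (conjSubgroup T I).relIndex I := by
    rw [relIndex_eq_of_factor (K := Iw p (m + 1) ⊓ parabolic p m) inf_le_left,
      ← Subgroup.relIndex_subgroupOf inf_le_right, Subgroup.inf_subgroupOf_right]
    · congr 1
      ext x
      rw [Subgroup.mem_subgroupOf, mem_conjSubgroup, mem_conjSubgroup, ← hTt]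
      rfl
    · intro x hx
      obtain ⟨k, hk, hkx⟩ := (isPositive_torusElt u).factor x hx
      exact ⟨k, ⟨borelIw_le hk, borelIw_le_parabolic hk⟩, hkx⟩
  -- The index splits along `T I T⁻¹ ≤ X ⊓ I ≤ I`: the upper step is the index in the Levi quotient.
  -- For the lower step, `X ⊓ I` is generated by `N ∩ I` and Levi elements in `T I T⁻¹`, leaving the
  -- unipotent index.
  let X := (conjSubgroup t (IwIg p m)).comap (leviProj p m)
  have hAX : conjSubgroup T I ≤ X := by
    intro x hx
    rw [mem_conjSubgroup] at hx
    have := leviProj_mem_IwIg (Subgroup.mem_subgroupOf.mp hx)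
    rw [map_mul, map_mul, map_inv, hT, leviProj_leviEmb] at this
    rwa [Subgroup.mem_comap, mem_conjSubgroup]
  have h2 : (conjSubgroup T I).relIndex (X ⊓ I) =
      (conjSubgroup T I).relIndex (unipotentRadical p m ⊓ I) := by
    refine relIndex_eq_of_factor (le_inf ?_ inf_le_right) ?_
    · intro x hx
      have hx1 : leviProj p m x = 1 := hx.1
      rw [Subgroup.mem_comap, hx1]
      exact Subgroup.one_mem _
    · intro x hx
      refine ⟨x * (leviEmb p m (leviProj p m x))⁻¹, ⟨mul_leviEmb_inv_mem x, I.mul_mem hx.2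
        (I.inv_mem (leviEmb_mem_Iw (leviProj_mem_IwIg hx.2)))⟩, ?_⟩
      rw [mem_conjSubgroup]
      have h3 := leviEmb_mem_Iw (mem_conjSubgroup.mp hx.1)
      rw [Subgroup.mem_subgroupOf]
      convert h3 using 2
      rw [map_mul, map_mul, map_inv, hT]
      group
  rw [h1, ← relIndex_unipotent, ← hI, ← hT, ← h2, ← map_leviProj_Iw, ← Subgroup.relIndex_comap,
    map_leviProj_Iw, Subgroup.relIndex_inf_mul_relIndex, inf_eq_left.mpr hAX]

end Index

/-! ### The modular character -/

section Modular

variable {p : ℕ} [Fact p.Prime] {m : ℕ}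

variable (p m) in
/-- Coordinates on the Lie algebra of `N`. -/
def lieNEquiv : lieN p m ≃ₗ[ℚ_[p]] (Fin m → ℚ_[p]) where
  toFun X j := X.1 0 j.succ
  map_add' _ _ := rfl
  map_smul' _ _ := rfl
  invFun x := ⟨Matrix.of (Fin.cons (Fin.cons 0 x) fun _ => 0), rfl, fun _ _ => rfl⟩
  left_inv X := by
    refine Subtype.ext (Matrix.ext fun i j => ?_)
    refine Fin.cases ?_ (fun i => ?_) i
    · refine Fin.cases ?_ (fun j => ?_) j
      · exact X.2.1.symm
      · rfl
    · exact (X.2.2 i j).symm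
  right_inv x := rfl

theorem det_adN_torus (u : Uminus (m + 1)) :
    LinearMap.det (adN p m (leviEmb p m (torusEltLevi p m u))) =
      ∏ j : Fin m, (p : ℚ_[p]) ^ ((Multiplicative.toAdd u).1.1 0 -
        (Multiplicative.toAdd u).1.1 j.succ) := by
  rw [← LinearMap.det_conj _ (lieNEquiv p m), ← Matrix.det_diagonal, ← LinearMap.det_toLin']
  congr 1
  refine LinearMap.ext fun x => funext fun j => ?_
  rw [Matrix.toLin'_apply, Matrix.mulVec_diagonal]
  have h1 : (((leviEmb p m (torusEltLevi p m u))⁻¹).1.1 : Matrix (Fin (m + 1)) (Fin (m + 1)) ℚ_[p]) =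
      Matrix.diagonal fun i => (p : ℚ_[p]) ^ (-(Multiplicative.toAdd u).1.1 i) := by
    have : ((leviEmb p m (torusEltLevi p m u))⁻¹).1 = (torusElt p u)⁻¹ := by
      rw [← coe_leviEmb_torusEltLevi]
      rfl
    rw [this]
    change (((diagPow p (Multiplicative.toAdd u).1.1)⁻¹ : GL (Fin (m + 1)) ℚ_[p]) :
      Matrix (Fin (m + 1)) (Fin (m + 1)) ℚ_[p]) = _
    rw [diagPow_inv, diagPow_coe]
    rfl
  have h2 : ((leviEmb p m (torusEltLevi p m u)).1.1 : Matrix (Fin (m + 1)) (Fin (m + 1)) ℚ_[p]) =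
      Matrix.diagonal fun i => (p : ℚ_[p]) ^ ((Multiplicative.toAdd u).1.1 i) := by
    rw [coe_leviEmb_torusEltLevi]
    exact diagPow_coe p _
  change (((leviEmb p m (torusEltLevi p m u)).1.1 : Matrix (Fin (m + 1)) (Fin (m + 1)) ℚ_[p]) *
    ((lieNEquiv p m).symm x).1 * (((leviEmb p m (torusEltLevi p m u))⁻¹).1.1 : Matrix (Fin (m + 1)) (Fin (m + 1)) ℚ_[p]))
    0 j.succ = _
  rw [h1, h2, Matrix.mul_diagonal, Matrix.diagonal_mul]
  have h3 : ((lieNEquiv p m).symm x).1 0 j.succ = x j := rfl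
  rw [h3, sub_eq_add_neg, zpow_add₀ (padic_p_ne_zero p)]
  ring

/-- `Ad(t)` is diagonal on `Lie N` with eigenvalues `p ^ (a_1 - a_j)`, and `|p| = p⁻¹`. Dominance
makes the exponents nonnegative, so the inverse is a natural number, namely `[N₀ : t N₀ t⁻¹]`. -/
theorem modularChar_torus (E : Type*) [Field E] [CharZero E] (u : Uminus (m + 1)) :
    (modularChar p m E (leviEmb p m (torusEltLevi p m u)))⁻¹ =
      ((∏ j : Fin m, p ^ ((Multiplicative.toAdd u).1.1 0 -
        (Multiplicative.toAdd u).1.1 j.succ).toNat : ℕ) : E) := by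
  have hu : Antitone (Multiplicative.toAdd u).1.1 := (Multiplicative.toAdd u).2
  have h1 : modularChar p m E (leviEmb p m (torusEltLevi p m u)) =
      ((padicNormE (LinearMap.det (adN p m (leviEmb p m (torusEltLevi p m u)))) : ℚ) : E) := rfl
  have h2 : padicNormE (p : ℚ_[p]) = (p : ℚ)⁻¹ := by
    have := padicNormE.eq_padic_norm' (p := p) (p : ℚ)
    rw [padicNorm.padicNorm_p_of_prime] at this
    exact_mod_cast this
  rw [h1, det_adN_torus, map_prod]
  simp only [map_zpow₀, h2]
  push_cast
  rw [← Finset.prod_inv_distrib]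
  refine Finset.prod_congr rfl fun j _ => ?_
  rw [inv_zpow, inv_inv, ← zpow_natCast,
    Int.toNat_of_nonneg (sub_nonneg.mpr (hu (Fin.zero_le _)))]

end Modular

/-! ### Injectivity of the Hecke operator of `diag(p, 1, …, 1)` -/

section Reflections

variable {p : ℕ} [Fact p.Prime] {n : ℕ}

/-- An adjacent transposition reverses the order of just one pair; in the Iwahori condition only the
entry at `(b, a)` is therefore at risk. -/
theorem swap_lt_swap {a b : Fin n} (hab : (b : ℕ) = a + 1) {i j : Fin n} (hij : j < i)
    (h : ¬ (i = b ∧ j = a)) : Equiv.swap a b j < Equiv.swap a b i := by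
  simp only [Equiv.swap_apply_def]
  rw [Fin.lt_def] at hij
  rw [Fin.ext_iff, Fin.ext_iff] at h
  split_ifs <;> simp only [Fin.ext_iff, Fin.lt_def] at * <;> omega

theorem permGL_swap_mul_self (a b : Fin n) :
    permGL (F := ℚ_[p]) (Equiv.swap a b) * permGL (Equiv.swap a b) = 1 := by
  rw [← permGL_mul, Equiv.swap_mul_self, permGL_one]

theorem permGL_swap_conj_apply (a b : Fin n) (g : GL (Fin n) ℚ_[p]) (i j : Fin n) :
    (permGL (Equiv.swap a b) * g * permGL (Equiv.swap a b) : GL (Fin n) ℚ_[p]) i j =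
      g (Equiv.swap a b i) (Equiv.swap a b j) := by
  rw [mul_permGL_apply, permGL_mul_apply, Equiv.symm_swap]

theorem permGL_swap_conj_mem {a b : Fin n} (hab : (b : ℕ) = a + 1) {g : GL (Fin n) ℚ_[p]}
    (hg : g ∈ iwahori p n) (h : ‖g a b‖ < 1) :
    permGL (Equiv.swap a b) * g * permGL (Equiv.swap a b) ∈ iwahori p n := by
  rw [mem_iwahori] at hg ⊢
  refine ⟨Subgroup.mul_mem _ (Subgroup.mul_mem _ (permGL_mem_integralGL _) hg.1)
    (permGL_mem_integralGL _), fun i j hij => ?_⟩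
  rw [permGL_swap_conj_apply]
  by_cases hc : i = b ∧ j = a
  · rw [hc.1, hc.2, Equiv.swap_apply_right, Equiv.swap_apply_left]
    exact h
  · exact hg.2 _ _ (swap_lt_swap hab hij hc)

/-- The elementary unipotent matrix `1 + y E_{ab}`. -/
def elemUnip {a b : Fin n} (hab : a < b) (y : ℚ_[p]) : GL (Fin n) ℚ_[p] :=
  colUnip b (Pi.single a y) (by rw [Pi.single_eq_of_ne hab.ne'])

theorem elemUnip_mul_apply {a b : Fin n} (hab : a < b) (y : ℚ_[p]) (g : GL (Fin n) ℚ_[p])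
    (i j : Fin n) : (elemUnip hab y * g : GL (Fin n) ℚ_[p]) i j = g i j + (if i = a then y else 0) * g b j := by
  rw [elemUnip, colUnip_mul_apply, Pi.single_apply]

theorem elemUnip_mem_iwahori {a b : Fin n} (hab : a < b) {y : ℚ_[p]} (hy : ‖y‖ ≤ 1) :
    elemUnip hab y ∈ iwahori p n := by
  refine colUnip_mem_iwahori _ (fun i => ?_) fun i hi => ?_
  · rw [Pi.single_apply]
    split
    · exact hy
    · simp
  · rw [Pi.single_eq_of_ne (hab.trans hi).ne', norm_zero]
    exact zero_lt_one

/-- The Iwahori subgroup and an adjacent transposition `s` satisfy `s I s ⊆ I ∪ I s I`. -/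
theorem swap_conj_mem_or {a b : Fin n} (hab : (b : ℕ) = a + 1) {g : GL (Fin n) ℚ_[p]}
    (hg : g ∈ iwahori p n) :
    permGL (Equiv.swap a b) * g * permGL (Equiv.swap a b) ∈ iwahori p n ∨
      ∃ x ∈ iwahori p n, ∃ y ∈ iwahori p n,
        permGL (Equiv.swap a b) * g * permGL (Equiv.swap a b) =
          x * permGL (Equiv.swap a b) * y := by
  have hlt : a < b := by rw [Fin.lt_def]; omega
  have hI := mem_iwahori.mp hg
  have hint := (mem_integralGL.mp hI.1).1
  by_cases h : ‖g a b‖ < 1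
  · exact Or.inl (permGL_swap_conj_mem hab hg h)
  right
  have h1 : ‖g a b‖ = 1 := le_antisymm (hint a b) (not_lt.mp h)
  have h0 : g a b ≠ 0 := fun h0 => by rw [h0, norm_zero] at h1; exact zero_ne_one h1
  set s : GL (Fin n) ℚ_[p] := permGL (Equiv.swap a b) with hs
  have hss : s * s = 1 := permGL_swap_mul_self a b
  -- This makes the entry at `(a, a)` of `elemUnip hlt y * (s * g * s)` zero; the further factor `s`
  -- moves it to `(b, a)`, the one critical place below the diagonal.
  set y : ℚ_[p] := -(g b b / g a b) with hy
  have hy1 : ‖y‖ ≤ 1 := by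
    rw [hy, norm_neg, norm_div, h1, div_one]
    exact hint b b
  have hE := elemUnip_mem_iwahori hlt hy1
  refine ⟨(elemUnip hlt y)⁻¹, (iwahori p n).inv_mem hE,
    s * (elemUnip hlt y * (s * g * s)), ?_, ?_⟩
  · refine mem_iwahori.mpr ⟨Subgroup.mul_mem _ (permGL_mem_integralGL _)
      (Subgroup.mul_mem _ (mem_iwahori.mp hE).1 (Subgroup.mul_mem _ (Subgroup.mul_mem _
        (permGL_mem_integralGL _) hI.1) (permGL_mem_integralGL _))), fun i j hij => ?_⟩
    rw [hs, permGL_mul_apply, elemUnip_mul_apply, permGL_swap_conj_apply, permGL_swap_conj_apply,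
      Equiv.symm_swap, Equiv.swap_apply_self, Equiv.swap_apply_right]
    by_cases hib : i = b
    · subst hib
      rw [Equiv.swap_apply_right, if_pos rfl]
      by_cases hja : j = a
      · subst hja
        rw [Equiv.swap_apply_left, hy]
        field_simp
        simp
      · have hj : j < a := by
          rw [Fin.lt_def] at hij ⊢
          rw [Fin.ext_iff] at hja
          omega
        rw [Equiv.swap_apply_of_ne_of_ne hj.ne hij.ne]
        exact (Padic.nonarchimedean _ _).trans_lt
          (max_lt (hI.2 _ _ hij) (norm_mul_lt_one_right hy1 (hI.2 _ _ hj)))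
    · have hia : Equiv.swap a b i ≠ a := by
        intro h
        apply hib
        exact ((Equiv.swap_apply_eq_iff).mp h).trans (Equiv.swap_apply_left a b)
      rw [if_neg hia, zero_mul, add_zero]
      by_cases hi : i = a
      · subst hi
        rw [Equiv.swap_apply_of_ne_of_ne hij.ne (hij.trans hlt).ne]
        exact hI.2 _ _ hij
      · have := swap_lt_swap hab hij fun h => hib h.1
        rw [Equiv.swap_apply_of_ne_of_ne hi hib] at this
        exact hI.2 _ _ this
  · rw [mul_assoc _ s, ← mul_assoc s s, hss, one_mul, inv_mul_cancel_left]

end Reflections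

/-! ### Injectivity along a reduced word and for `diag(p^s, 1, …, 1)`. -/

section Injectivity

variable {E V : Type*} [Field E] [CharZero E] [AddCommGroup V] [Module E V]
variable {p : ℕ} [Fact p.Prime]

theorem adjacent_swap_criterion {n : ℕ} {π : Representation E (GG p n) V} (hπ : IsSmooth π)
    {a b : Fin n} (hab : (b : ℕ) = a + 1) :
    ∀ v ∈ fixedBy π (Iw p n), π (permGL (Equiv.swap a b), 1) v ∈ augmentation π (Iw p n) →
      v = 0 := by
  refine injective_criterion_reflection (hπ.isLocallyFinite (isCompact_Iw p n))
    (relIndex_conj_ne_zero (isOpen_Iw p n) (isCompact_Iw p n) _)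
    (Prod.ext (permGL_swap_mul_self a b) (one_mul _)) fun x hx => ?_
  have hx2 : (1 * x.2 * 1 : ℚ_[p]ˣ) = x.2 := by simp
  rcases swap_conj_mem_or hab (mem_Iw.mp hx).1 with h | ⟨y, hy, z, hz, h⟩
  · refine Or.inl (mem_Iw.mpr ⟨h, ?_⟩)
    change (1 * x.2 * 1 : ℚ_[p]ˣ) ∈ _
    rw [hx2]
    exact (mem_Iw.mp hx).2
  · refine Or.inr ⟨(y, 1), mem_Iw.mpr ⟨hy, Subgroup.one_mem _⟩, (z, x.2),
      mem_Iw.mpr ⟨hz, (mem_Iw.mp hx).2⟩, Prod.ext h ?_⟩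
    change (1 * x.2 * 1 : ℚ_[p]ˣ) = 1 * 1 * x.2
    simp

variable {m : ℕ} {π : Representation E (GG p (m + 1)) V}

/-- The cycle is built as the product of the adjacent transpositions `(0 1), (1 2), …`, adding one
factor on the right at a time. Each multiplication is length-additive, so the criterion passes from
the factors to the product. -/
theorem exists_cycle_criterion (hπ : IsSmooth π) (k : ℕ) (hk : k ≤ m) :
    ∃ σ : Equiv.Perm (Fin (m + 1)), (∀ j : Fin (m + 1), (j : ℕ) = k → σ j = 0) ∧
      (∀ j : Fin (m + 1), (j : ℕ) < k → (σ j : ℕ) = j + 1) ∧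
      (∀ j : Fin (m + 1), k < j → σ j = j) ∧
      ∀ v ∈ fixedBy π (Iw p (m + 1)), π (permGL σ, 1) v ∈ augmentation π (Iw p (m + 1)) →
        v = 0 := by
  have hlf := hπ.isLocallyFinite (isCompact_Iw p (m + 1))
  induction k with
  | zero =>
    refine ⟨1, fun j hj => Fin.ext hj, fun j hj => absurd hj (Nat.not_lt_zero _), fun j _ => rfl,
      fun v hv h => ?_⟩
    have h1 : ((permGL 1, 1) : GG p (m + 1)) = 1 := Prod.ext permGL_one rfl
    rw [h1, map_one] at h
    exact eq_zero_of_fixed_of_mem_augmentation hlf hv h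
  | succ k ih =>
    obtain ⟨σ, h1, h2, h3, h4⟩ := ih (by omega)
    let a : Fin (m + 1) := ⟨k, by omega⟩
    let b : Fin (m + 1) := ⟨k + 1, by omega⟩
    have hab : (b : ℕ) = a + 1 := rfl
    have hlt : a < b := by rw [Fin.lt_def]; omega
    refine ⟨σ * Equiv.swap a b, fun j hj => ?_, fun j hj => ?_, fun j hj => ?_, ?_⟩
    · have : j = b := Fin.ext hj
      rw [this, Equiv.Perm.mul_apply, Equiv.swap_apply_right]
      exact h1 a rfl
    · rw [Equiv.Perm.mul_apply]
      by_cases hja : j = a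
      · rw [hja, Equiv.swap_apply_left, h3 b (Nat.lt_succ_self k)]
      · have hjk : (j : ℕ) ≠ k := fun h => hja (Fin.ext h)
        rw [Equiv.swap_apply_of_ne_of_ne hja (fun h => by rw [h] at hj; exact lt_irrefl _ hj)]
        exact h2 j (by omega)
    · have hja : j ≠ a := fun h => by
        rw [h] at hj
        change k + 1 < k at hj
        omega
      have hjb : j ≠ b := fun h => by
        rw [h] at hj
        exact lt_irrefl _ hj
      rw [Equiv.Perm.mul_apply, Equiv.swap_apply_of_ne_of_ne hja hjb]
      exact h3 j (by omega)
    · have hmul : ((permGL (σ * Equiv.swap a b), 1) : GG p (m + 1)) =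
          (permGL σ, 1) * (permGL (Equiv.swap a b), 1) :=
        Prod.ext (permGL_mul _ _) (one_mul _).symm
      rw [hmul]
      refine injective_criterion_mul
        -- `K` consists of the Iwahori elements that stay Iwahori after conjugation by `σ`. It
        -- contains the root group at `(a, b)`, because `σ a = 0` moves it into the top row (length
        -- additivity).
        (K := Iw p (m + 1) ⊓ conjSubgroup (permGL σ, 1)⁻¹ (Iw p (m + 1))) hlf inf_le_left
        (relIndex_conj_ne_zero (isOpen_Iw p _) (isCompact_Iw p _) _) (fun x hx => ?_)
        (fun k hk => ?_) h4 (adjacent_swap_criterion hπ hab)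
      · have hx1 := (mem_Iw.mp hx).1
        have hd := norm_diag_of_mem_iwahori hx1 b
        have hd0 : x.1 b b ≠ 0 := fun h0 => by rw [h0, norm_zero] at hd; exact zero_ne_one hd
        -- Chosen to clear the entry of `x` at `(a, b)`, the only obstruction to conjugating by the
        -- transposition within the Iwahori subgroup.
        set y : ℚ_[p] := -(x.1 a b / x.1 b b) with hy
        have hy1 : ‖y‖ ≤ 1 := by
          rw [hy, norm_neg, norm_div, hd, div_one]
          exact (mem_integralGL.mp (mem_iwahori.mp hx1).1).1 a b
        have hE := elemUnip_mem_iwahori hlt hy1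
        have hEσ : permGL σ * elemUnip hlt y * (permGL σ)⁻¹ ∈ iwahori p (m + 1) := by
          refine mem_iwahori.mpr ⟨Subgroup.mul_mem _ (Subgroup.mul_mem _
            (permGL_mem_integralGL _) (mem_iwahori.mp hE).1)
            (Subgroup.inv_mem _ (permGL_mem_integralGL _)), fun i j hij => ?_⟩
          have hi : σ.symm i ≠ a := by
            intro h
            have : i = σ a := by rw [← h, Equiv.apply_symm_apply]
            rw [this, h1 a rfl] at hij
            exact Fin.not_lt_zero j hij
          rw [permGL_conj_apply, elemUnip, colUnip_apply, Pi.single_eq_of_ne hi,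
            Matrix.one_apply_ne (fun h => hij.ne' (σ.symm.injective h))]
          simp
        have hK : ((elemUnip hlt y, 1) : GG p (m + 1)) ∈
            Iw p (m + 1) ⊓ conjSubgroup (permGL σ, 1)⁻¹ (Iw p (m + 1)) := by
          refine Subgroup.mem_inf.mpr
            ⟨mem_Iw.mpr ⟨hE, Subgroup.one_mem _⟩, mem_conjSubgroup.mpr ?_⟩
          rw [inv_inv, mem_Iw]
          exact ⟨hEσ, by simp⟩
        refine ⟨(elemUnip hlt y, 1)⁻¹, Subgroup.inv_mem _ hK, ?_⟩
        · rw [mem_conjSubgroup, mem_Iw]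
          have hs : (permGL (F := ℚ_[p]) (Equiv.swap a b))⁻¹ = permGL (Equiv.swap a b) := by
            rw [permGL_inv, Equiv.swap_inv]
          constructor
          · change (permGL (Equiv.swap a b))⁻¹ * ((elemUnip hlt y)⁻¹⁻¹ * x.1) *
              permGL (Equiv.swap a b) ∈ iwahori p (m + 1)
            rw [hs, inv_inv]
            refine permGL_swap_conj_mem hab ((iwahori p _).mul_mem hE hx1) ?_
            rw [elemUnip_mul_apply, if_pos rfl, hy]
            field_simp
            simp
          · change (1 : ℚ_[p]ˣ)⁻¹ * ((1 : ℚ_[p]ˣ)⁻¹⁻¹ * x.2) * 1 ∈ integralUnits p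
            simpa using (mem_Iw.mp hx).2
      · have := mem_conjSubgroup.mp hk.2
        simpa using this

theorem norm_inv_p_mul_le {x : ℚ_[p]} (hx : ‖x‖ < 1) : ‖(p : ℚ_[p])⁻¹ * x‖ ≤ 1 := by
  have hp : (0 : ℝ) < p := by exact_mod_cast (Fact.out : p.Prime).pos
  have h := (Padic.norm_le_pow_iff_norm_lt_pow_add_one x (-1)).mpr (by simpa using hx)
  rw [norm_mul, norm_inv, Padic.norm_p, inv_inv]
  rw [zpow_neg_one] at h
  calc (p : ℝ) * ‖x‖ ≤ p * (p : ℝ)⁻¹ := mul_le_mul_of_nonneg_left h hp.le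
    _ = 1 := mul_inv_cancel₀ hp.ne'

variable (m) in
/-- The element `U(s, 0, …, 0; 0)`. -/
def firstWeight (s : ℕ) : Uminus (m + 1) :=
  Multiplicative.ofAdd ⟨(Fin.cons (s : ℤ) 0, 0), fun i j hij => by
    rcases Fin.eq_zero_or_eq_succ i with rfl | ⟨i, rfl⟩
    · rcases Fin.eq_zero_or_eq_succ j with rfl | ⟨j, rfl⟩ <;> simp
    · rcases Fin.eq_zero_or_eq_succ j with rfl | ⟨j, rfl⟩
      · exact absurd hij (not_le.mpr (Fin.succ_pos i))
      · simp⟩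

/-- Write `t = w (w⁻¹ t)` with `w` the full cycle. The element `w⁻¹ t` has length zero: it carries
Iwahori-fixed vectors to Iwahori-fixed vectors, so the criterion for `w` applies to `w⁻¹ t v`. -/
theorem firstWeight_one_criterion (hπ : IsSmooth π) :
    ∀ v ∈ fixedBy π (Iw p (m + 1)),
      π (torusElt p (firstWeight m 1)) v ∈ augmentation π (Iw p (m + 1)) → v = 0 := by
  intro v hv htv
  obtain ⟨σ, h1, h2, -, h4⟩ := exists_cycle_criterion hπ m le_rfl
  set t := torusElt p (firstWeight m 1) with ht
  set w : GG p (m + 1) := (permGL σ, 1) with hw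
  have hσ0 : σ.symm 0 = Fin.last m := by
    rw [Equiv.symm_apply_eq]
    exact (h1 _ rfl).symm
  have hσs : ∀ i : Fin m, σ.symm i.succ = i.castSucc := by
    intro i
    rw [Equiv.symm_apply_eq]
    exact Fin.ext (h2 i.castSucc i.2).symm
  -- The cycle moves the last row and column of `g` to the front. The new first row comes from
  -- entries below the diagonal and absorbs the factor `p⁻¹`; the new first column gains `p` and so
  -- becomes topologically nilpotent.
  have key : ∀ g ∈ iwahori p (m + 1), ∀ i j,
      ‖((diagPow p (Fin.cons 1 0 : Fin (m + 1) → ℤ))⁻¹ * (permGL σ * g * (permGL σ)⁻¹) *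
        diagPow p (Fin.cons 1 0 : Fin (m + 1) → ℤ) : GL (Fin (m + 1)) ℚ_[p]) i j‖ ≤ 1 ∧
      (j < i → ‖((diagPow p (Fin.cons 1 0 : Fin (m + 1) → ℤ))⁻¹ *
        (permGL σ * g * (permGL σ)⁻¹) * diagPow p (Fin.cons 1 0 : Fin (m + 1) → ℤ) :
          GL (Fin (m + 1)) ℚ_[p]) i j‖ < 1) := by
    intro g hg i j
    have hI := mem_iwahori.mp hg
    have hint := (mem_integralGL.mp hI.1).1
    rw [diagPow_inv_conj_apply, permGL_conj_apply]
    refine Fin.cases ?_ (fun i => ?_) i <;> refine Fin.cases ?_ (fun j => ?_) j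
    · rw [hσ0, sub_self, zpow_zero, one_mul]
      exact ⟨hint _ _, fun h => absurd h (lt_irrefl _)⟩
    · rw [hσ0, hσs]
      refine ⟨?_, fun h => absurd h (Fin.not_lt_zero _)⟩
      simpa using norm_inv_p_mul_le (hI.2 _ _ (Fin.castSucc_lt_last j))
    · rw [hσ0, hσs]
      have hp : ‖(p : ℚ_[p])‖ < 1 := Padic.norm_p_lt_one
      have := norm_mul_lt_one_left hp (hint i.castSucc (Fin.last m))
      have h3 : (Fin.cons 1 0 : Fin (m + 1) → ℤ) 0 - (Fin.cons 1 0 : Fin (m + 1) → ℤ) i.succ = 1 := by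
        simp
      rw [h3, zpow_one]
      exact ⟨this.le, fun _ => this⟩
    · rw [hσs, hσs]
      simp only [Fin.cons_succ, Pi.zero_apply, sub_self, zpow_zero, one_mul]
      exact ⟨hint _ _, fun h => hI.2 _ _ (Fin.castSucc_lt_castSucc_iff.mpr
        (Fin.succ_lt_succ_iff.mp h))⟩
  have hfix : π (w⁻¹ * t) v ∈ fixedBy π (Iw p (m + 1)) := by
    rw [mem_fixedBy]
    intro h hh
    have hmem : (w⁻¹ * t)⁻¹ * h * (w⁻¹ * t) ∈ Iw p (m + 1) := by
      have h3 : (w⁻¹ * t)⁻¹ * h * (w⁻¹ * t) = t⁻¹ * (w * h * w⁻¹) * t := by group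
      rw [h3, torusElt_conj, mem_Iw]
      have hh1 := (mem_Iw.mp hh).1
      have hinv : ((diagPow p (Fin.cons 1 0 : Fin (m + 1) → ℤ))⁻¹ *
          (permGL σ * h.1 * (permGL σ)⁻¹) * diagPow p (Fin.cons 1 0 : Fin (m + 1) → ℤ))⁻¹ =
          (diagPow p (Fin.cons 1 0 : Fin (m + 1) → ℤ))⁻¹ * (permGL σ * h.1⁻¹ * (permGL σ)⁻¹) *
            diagPow p (Fin.cons 1 0 : Fin (m + 1) → ℤ) := by group
      refine ⟨mem_iwahori.mpr ⟨mem_integralGL.mpr ⟨fun i j => (key _ hh1 i j).1, fun i j => ?_⟩,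
        fun i j hij => (key _ hh1 i j).2 hij⟩, ?_⟩
      · have := (key _ ((iwahori p _).inv_mem hh1) i j).1
        rw [← hinv] at this
        exact this
      · change (1 : ℚ_[p]ˣ) * h.2 * (1 : ℚ_[p]ˣ)⁻¹ ∈ integralUnits p
        simpa using (mem_Iw.mp hh).2
    have h5 := (mem_fixedBy π).mp hv _ hmem
    have h6 := congrArg (π (w⁻¹ * t)) h5
    rw [← Module.End.mul_apply, ← map_mul] at h6 ⊢
    rw [← h6]
    congr 2
    group
  have h0 : π (w⁻¹ * t) v = 0 := by
    refine h4 _ hfix ?_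
    rw [← Module.End.mul_apply, ← map_mul, mul_inv_cancel_left]
    exact htv
  have := congrArg (π (w⁻¹ * t)⁻¹) h0
  rwa [← Module.End.mul_apply, ← map_mul, inv_mul_cancel, map_one, map_zero] at this

theorem firstWeight_add (s s' : ℕ) : firstWeight m (s + s') = firstWeight m s * firstWeight m s' := by
  refine congrArg Multiplicative.ofAdd (Subtype.ext (Prod.ext (funext fun i => ?_) rfl))
  refine Fin.cases ?_ (fun i => ?_) i
  · exact Nat.cast_add _ _
  · rfl

theorem firstWeight_zero : firstWeight m 0 = 1 := by
  refine congrArg Multiplicative.ofAdd (Subtype.ext (Prod.ext (funext fun i => ?_) rfl))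
  refine Fin.cases ?_ (fun i => ?_) i <;> rfl

theorem heckeRep_firstWeight_injective (hπ : IsSmooth π) (s : ℕ) :
    Function.Injective (heckeRep π hπ (firstWeight m s)) := by
  induction s with
  | zero =>
    rw [firstWeight_zero, map_one]
    exact fun _ _ h => h
  | succ s ih =>
    rw [firstWeight_add, map_mul]
    refine ih.comp ((injective_iff_map_eq_zero _).mpr fun v hv => Subtype.ext ?_)
    refine firstWeight_one_criterion hπ v v.2 ?_
    have hfin := relIndex_conj_ne_zero (isOpen_Iw p (m + 1)) (isCompact_Iw p _)
      (torusElt p (firstWeight m 1))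
    have h1 := heckeOperator_sub_mem_self (ρ := π) hfin v
    have h2 : (heckeOperator π (Iw p (m + 1)) (torusElt p (firstWeight m 1)) v : V) = 0 :=
      congrArg Subtype.val hv
    rwa [h2, zero_sub, Submodule.neg_mem_iff,
      Submodule.smul_mem_iff _ (Nat.cast_ne_zero.mpr hfin)] at h1

end Injectivity

/-! ### The map to the Jacquet module -/

section JacquetMap

variable {E V : Type*} [Field E] [AddCommGroup V] [Module E V]
variable {p : ℕ} [Fact p.Prime] {m : ℕ} (π : Representation E (GG p (m + 1)) V)

theorem jacquet_jacquetMk (l : Levi p m) (v : V) :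
    jacquet π l (jacquetMk π v) = jacquetMk π (π (leviEmb p m l) v) := rfl

theorem jacquetMk_unipotent {k : parabolic p m} (hk : k ∈ unipotentRadical p m) (v : V) :
    jacquetMk π (π k v) = jacquetMk π v :=
  Representation.Coinvariants.mk_self_apply
    ((π.comp (parabolic p m).subtype).comp (unipotentRadical p m).subtype) ⟨k, hk⟩ v

theorem jacquetMk_parabolic (k : parabolic p m) (v : V) :
    jacquetMk π (π k v) = jacquet π (leviProj p m k) (jacquetMk π v) := by
  have h : π k v = π (k * (leviEmb p m (leviProj p m k))⁻¹ : parabolic p m)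
      (π (leviEmb p m (leviProj p m k)) v) := by
    rw [← Module.End.mul_apply, ← map_mul, ← Subgroup.coe_mul, inv_mul_cancel_right]
  rw [h, jacquetMk_unipotent π (mul_leviEmb_inv_mem k), jacquet_jacquetMk]

/-- Only `P` acts on `π_N`, so only the part `Iw_p ∩ P` of the augmentation has a meaningful image.
This is why the congruences above are refined from `H` to a subgroup `K`. -/
theorem jacquetMk_mem_augmentation {x : V}
    (hx : x ∈ augmentation π (Iw p (m + 1) ⊓ parabolic p m)) :
    jacquetMk π x ∈ augmentation (jacquet π) (IwIg p m) := by
  suffices h : augmentation π (Iw p (m + 1) ⊓ parabolic p m) ≤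
    (augmentation (jacquet π) (IwIg p m)).comap (jacquetMk π) from h hx
  refine augmentation_le fun k hk u => ?_
  rw [Submodule.mem_comap, map_sub, jacquetMk_parabolic π ⟨k, hk.2⟩]
  exact sub_mem_augmentation (leviProj_mem_IwIg hk.1) _

theorem jacquetMk_mem_fixedBy {v : V} (hv : v ∈ fixedBy π (Iw p (m + 1))) :
    jacquetMk π v ∈ fixedBy (jacquet π) (IwIg p m) := by
  rw [mem_fixedBy] at hv ⊢
  intro l hl
  rw [jacquet_jacquetMk, hv _ (leviEmb_mem_Iw hl)]

variable {π}

/-- Lift the vector to `V` and pull its stabiliser back along `L_P → G`; finiteness of the index is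
inherited from `Iw_p`. -/
theorem IsSmooth.isLocallyFinite_jacquet (hπ : IsSmooth π) :
    IsLocallyFinite (jacquet π) (IwIg p m) := by
  intro w
  obtain ⟨v, rfl⟩ := Representation.Coinvariants.mk_surjective _ w
  obtain ⟨S, hS, hv⟩ := hπ.isLocallyFinite (isCompact_Iw p (m + 1)) v
  let f : Levi p m →* GG p (m + 1) := (parabolic p m).subtype.comp (leviEmb p m)
  refine ⟨S.comap f, ?_, ?_⟩
  · rw [Subgroup.relIndex_comap]
    intro h0
    refine hS (Subgroup.relIndex_eq_zero_of_le_right ?_ h0)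
    rintro _ ⟨l, hl, rfl⟩
    exact leviEmb_mem_Iw hl
  · rw [mem_fixedBy]
    intro l hl
    exact congrArg (jacquetMk π) ((mem_fixedBy π).mp hv _ hl)

theorem relIndex_conj_IwIg_ne_zero (u : Uminus (m + 1)) :
    (conjSubgroup (torusEltLevi p m u) (IwIg p m)).relIndex (IwIg p m) ≠ 0 := by
  have h := relIndex_conj_ne_zero (isOpen_Iw p (m + 1)) (isCompact_Iw p _) (torusElt p u)
  rw [relIndex_Iw_eq] at h
  exact right_ne_zero_of_mul h

variable [CharZero E]

/-- The image of `U(a, b) v` in the Jacquet module, modulo the augmentation of `Iw_Ig`. -/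
theorem jacquetMk_heckeOperator_sub_mem (hπ : IsSmooth π) (u : Uminus (m + 1))
    (v : fixedBy π (Iw p (m + 1))) :
    jacquetMk π (heckeOperator π (Iw p (m + 1)) (torusElt p u) v) -
      ((conjSubgroup (torusElt p u) (Iw p (m + 1))).relIndex (Iw p (m + 1)) : E) •
        jacquet π (torusEltLevi p m u) (jacquetMk π v) ∈
      augmentation (jacquet π) (IwIg p m) := by
  have hpos := isPositive_torusElt (p := p) u
  have h1 := heckeOperator_sub_mem (hπ.isLocallyFinite (isCompact_Iw p (m + 1))) borelIw_le
    hpos.finite hpos.factor v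
  have h2 := jacquetMk_mem_augmentation π
    (augmentation_mono (le_inf borelIw_le borelIw_le_parabolic) h1)
  rw [jacquet_jacquetMk, coe_leviEmb_torusEltLevi, ← map_smul, ← map_sub]
  exact h2

/-- The two Hecke operators are multiples of the same translate modulo augmentation, and their
indices differ by exactly `δ_P(t)⁻¹`. -/
theorem jacquetMk_heckeOperator (hπ : IsSmooth π) (u : Uminus (m + 1))
    (v : fixedBy π (Iw p (m + 1))) :
    jacquetMk π (heckeOperator π (Iw p (m + 1)) (torusElt p u) v) =
      (modularChar p m E (leviEmb p m (torusEltLevi p m u)))⁻¹ •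
        (heckeOperator (jacquet π) (IwIg p m) (torusEltLevi p m u)
          ⟨jacquetMk π v, jacquetMk_mem_fixedBy π v.2⟩ : JacquetModule π) := by
  refine smul_heckeOperator_eq_of_sub_mem hπ.isLocallyFinite_jacquet
    (relIndex_conj_IwIg_ne_zero u) _ (jacquetMk_mem_fixedBy π (Subtype.coe_prop _)) ?_
  rw [modularChar_torus E u, ← Nat.cast_mul, ← relIndex_Iw_eq]
  exact jacquetMk_heckeOperator_sub_mem hπ u v

end JacquetMap

/-! ### Bijectivity on invariants and transport of the action. -/

section Bijective

variable {E V : Type*} [Field E] [AddCommGroup V] [Module E V]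
variable {p : ℕ} [Fact p.Prime] {m : ℕ} {π : Representation E (GG p (m + 1)) V}

theorem eventually_norm_p_pow_mul_le (x : ℚ_[p]) :
    ∀ᶠ s : ℕ in Filter.atTop, ‖(p : ℚ_[p]) ^ s * x‖ ≤ 1 := by
  have h : Filter.Tendsto (fun s : ℕ => (p : ℚ_[p]) ^ s * x) Filter.atTop (nhds (0 * x)) :=
    (tendsto_pow_atTop_nhds_zero_of_norm_lt_one Padic.norm_p_lt_one).mul_const x
  rw [zero_mul] at h
  have := h.norm
  rw [norm_zero] at this
  exact this.eventually_le_const zero_lt_one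

theorem firstWeight_apply_zero (s : ℕ) :
    (Multiplicative.toAdd (firstWeight m s)).1.1 0 = s := rfl

theorem firstWeight_apply_succ (s : ℕ) (i : Fin m) :
    (Multiplicative.toAdd (firstWeight m s)).1.1 i.succ = 0 := rfl

theorem torusElt_firstWeight_conj (s : ℕ) (x : GG p (m + 1)) (j : Fin m) :
    (torusElt p (firstWeight m s) * x * (torusElt p (firstWeight m s))⁻¹).1 0 j.succ =
      (p : ℚ_[p]) ^ s * x.1 0 j.succ := by
  change (diagPow p (Multiplicative.toAdd (firstWeight m s)).1.1 * x.1 *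
    (diagPow p (Multiplicative.toAdd (firstWeight m s)).1.1)⁻¹ : GL (Fin (m + 1)) ℚ_[p]) 0 j.succ
    = _
  rw [diagPow_inv, mul_diagPow_apply, diagPow_mul_apply, Pi.neg_apply, firstWeight_apply_succ,
    firstWeight_apply_zero, neg_zero, zpow_zero, mul_one, zpow_natCast]

/-- The elements `t_s` contract the unipotent radical. -/
theorem eventually_conj_unipotent_mem {k : parabolic p m} (hk : k ∈ unipotentRadical p m) :
    ∀ᶠ s : ℕ in Filter.atTop, torusElt p (firstWeight m s) * (k : GG p (m + 1)) *
      (torusElt p (firstWeight m s))⁻¹ ∈ Iw p (m + 1) := by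
  have h1 : ∀ᶠ s : ℕ in Filter.atTop, ∀ j : Fin m, ‖(p : ℚ_[p]) ^ s * k.1.1 0 j.succ‖ ≤ 1 :=
    Filter.eventually_all.mpr fun j => eventually_norm_p_pow_mul_le _
  have h2 : ∀ᶠ s : ℕ in Filter.atTop, ∀ j : Fin m, ‖(p : ℚ_[p]) ^ s * k⁻¹.1.1 0 j.succ‖ ≤ 1 :=
    Filter.eventually_all.mpr fun j => eventually_norm_p_pow_mul_le _
  filter_upwards [h1, h2] with s hs hs'
  set T := leviEmb p m (torusEltLevi p m (firstWeight m s)) with hT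
  have hTt : (T : GG p (m + 1)) = torusElt p (firstWeight m s) := coe_leviEmb_torusEltLevi _
  have hconj : ∀ x : parabolic p m, ((T * x * T⁻¹ : parabolic p m) : GG p (m + 1)) =
      torusElt p (firstWeight m s) * (x : GG p (m + 1)) * (torusElt p (firstWeight m s))⁻¹ := by
    intro x
    rw [← hTt]
    rfl
  rw [← hconj]
  refine mem_Iw_of_mem_unipotentRadical
    ((inferInstance : (unipotentRadical p m).Normal).conj_mem _ hk _) (fun j => ?_) fun j => ?_
  · rw [hconj, torusElt_firstWeight_conj]
    exact hs j
  · have : (T * k * T⁻¹)⁻¹ = T * k⁻¹ * T⁻¹ := by group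
    rw [this, hconj, torusElt_firstWeight_conj]
    exact hs' j

/-- For a generator, `t (k u - u) = (t k t⁻¹)(t u) - t u`, and `t k t⁻¹` is in `Iw_p` once `s` is
large. Asking for all large `s` lets finite sums share one `s`. -/
theorem eventually_mem_augmentation {v : V} (hv : jacquetMk π v = 0) :
    ∀ᶠ s : ℕ in Filter.atTop, π (torusElt p (firstWeight m s)) v ∈
      augmentation π (Iw p (m + 1)) := by
  rw [Representation.Coinvariants.mk_eq_zero] at hv
  refine Submodule.span_induction ?_ ?_ ?_ ?_ hv
  · rintro _ ⟨⟨⟨k, hk⟩, u⟩, rfl⟩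
    filter_upwards [eventually_conj_unipotent_mem hk] with s hs
    have := sub_mem_augmentation (ρ := π) hs (π (torusElt p (firstWeight m s)) u)
    rw [← Module.End.mul_apply, ← map_mul, inv_mul_cancel_right, map_mul,
      Module.End.mul_apply, ← map_sub] at this
    exact this
  · exact Filter.Eventually.of_forall fun s => by rw [map_zero]; exact Submodule.zero_mem _
  · intro x y _ _ hx hy
    filter_upwards [hx, hy] with s hsx hsy
    rw [map_add]
    exact Submodule.add_mem _ hsx hsy
  · intro c x _ hx
    filter_upwards [hx] with s hsx
    rw [map_smul]
    exact Submodule.smul_mem _ _ hsx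

theorem jacquetMk_injective [CharZero E] (hπ : IsSmooth π) {v : V}
    (hv : v ∈ fixedBy π (Iw p (m + 1))) (h : jacquetMk π v = 0) : v = 0 := by
  obtain ⟨s, hs⟩ := (eventually_mem_augmentation h).exists
  have h1 : heckeRep π hπ (firstWeight m s) ⟨v, hv⟩ = 0 := by
    refine Subtype.ext ?_
    refine eq_zero_of_fixed_of_mem_augmentation (hπ.isLocallyFinite (isCompact_Iw p (m + 1)))
      (Subtype.coe_prop _) ?_
    have h2 := Submodule.add_mem _ (heckeOperator_sub_mem_self
      (relIndex_conj_ne_zero (isOpen_Iw p (m + 1)) (isCompact_Iw p _)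
        (torusElt p (firstWeight m s))) ⟨v, hv⟩)
      (Submodule.smul_mem _ ((conjSubgroup (torusElt p (firstWeight m s))
        (Iw p (m + 1))).relIndex (Iw p (m + 1)) : E) hs)
    rwa [sub_add_cancel] at h2
  exact congrArg Subtype.val ((injective_iff_map_eq_zero _).mp
    (heckeRep_firstWeight_injective hπ s) _ h1)

/-- Conjugation by `t_s⁻¹` contracts the opposite unipotent radical. -/
theorem exists_conj_colUnip_mem {S : Subgroup (GG p (m + 1))}
    (hS : IsOpen (S : Set (GG p (m + 1)))) :
    ∃ s : ℕ, ∀ (c : Fin (m + 1) → ℚ_[p]) (hc : c 0 = 0), (∀ i, ‖c i‖ ≤ 1) →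
      (torusElt p (firstWeight m s))⁻¹ * (colUnip 0 c hc, 1) * torusElt p (firstWeight m s) ∈
        S := by
  let f : (Fin m → ℚ_[p]) → GG p (m + 1) := fun c => (colUnip 0 (Fin.cons 0 c) rfl, 1)
  have hcons : Continuous fun c : Fin m → ℚ_[p] =>
      Matrix.vecMulVec (Fin.cons 0 c : Fin (m + 1) → ℚ_[p]) (Pi.single (0 : Fin (m + 1)) 1) := by
    refine continuous_matrix fun i j => ?_
    refine Continuous.mul ?_ continuous_const
    refine Fin.cases ?_ (fun i => ?_) i
    · exact continuous_const
    · exact continuous_apply i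
  have hf : Continuous f := by
    refine Continuous.prodMk (Units.continuous_iff.mpr ⟨?_, ?_⟩) continuous_const
    · exact continuous_const.add hcons
    · exact continuous_const.sub hcons
  have hf0 : f 0 = 1 := by
    refine Prod.ext (Units.ext (Matrix.ext fun i j => ?_)) rfl
    change colUnip 0 (Fin.cons 0 0) rfl i j = (1 : Matrix (Fin (m + 1)) (Fin (m + 1)) ℚ_[p]) i j
    refine (colUnip_apply _ _ _ i j).trans ?_
    have : (Fin.cons 0 0 : Fin (m + 1) → ℚ_[p]) i = 0 := by
      refine Fin.cases rfl (fun i => rfl) i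
    rw [this]
    simp
  have hnhds : f ⁻¹' S ∈ nhds 0 := by
    refine (hS.preimage hf).mem_nhds ?_
    rw [Set.mem_preimage, hf0]
    exact S.one_mem
  obtain ⟨ε, hε, hball⟩ := Metric.mem_nhds_iff.mp hnhds
  have hp : (p : ℝ)⁻¹ < 1 := inv_lt_one_of_one_lt₀ (by exact_mod_cast (Fact.out : p.Prime).one_lt)
  obtain ⟨s, hs⟩ := exists_pow_lt_of_lt_one hε hp
  refine ⟨s, fun c hc h1 => ?_⟩
  have hmem : f (fun i => (p : ℚ_[p]) ^ s * c i.succ) ∈ S := by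
    refine hball ?_
    rw [Metric.mem_ball, dist_zero_right, pi_norm_lt_iff hε]
    intro i
    rw [norm_mul, norm_pow, Padic.norm_p]
    exact (mul_le_of_le_one_right (by positivity) (h1 _)).trans_lt hs
  have heq : (torusElt p (firstWeight m s))⁻¹ * (colUnip 0 c hc, 1) *
      torusElt p (firstWeight m s) = f (fun i => (p : ℚ_[p]) ^ s * c i.succ) := by
    rw [torusElt_conj]
    refine Prod.ext (Units.ext (Matrix.ext fun i j => ?_)) rfl
    refine (diagPow_inv_conj_apply p _ _ i j).trans ?_
    change _ = colUnip 0 (Fin.cons 0 fun i => (p : ℚ_[p]) ^ s * c i.succ) rfl i j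
    refine Eq.trans ?_ (colUnip_apply _ _ _ i j).symm
    rw [colUnip_apply]
    rcases Fin.eq_zero_or_eq_succ j with rfl | ⟨j, rfl⟩
    · rcases Fin.eq_zero_or_eq_succ i with rfl | ⟨i, rfl⟩
      · simp [hc]
      · rw [firstWeight_apply_succ, firstWeight_apply_zero]
        simp
    · by_cases hij : i = j.succ
      · simp [hij]
      · simp [Matrix.one_apply_ne hij, Fin.succ_ne_zero]
  rw [heq]
  exact hmem

/-- The `GL_m` component is trivial, so translation by this element preserves `Iw_Ig`-invariants. -/
theorem torusEltLevi_firstWeight_comm (s : ℕ) (l : Levi p m) :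
    l * torusEltLevi p m (firstWeight m s) = torusEltLevi p m (firstWeight m s) * l := by
  refine Prod.ext (mul_comm _ _) (Prod.ext ?_ (mul_comm _ _))
  have : (torusEltLevi p m (firstWeight m s)).2.1 = 1 := diagPow_zero p
  rw [Prod.snd_mul, Prod.fst_mul, Prod.snd_mul, Prod.fst_mul, this, mul_one, one_mul]

/-- Jacquet's lemma: every vector of `π_N^{Iw_Ig}` lifts to `π^{Iw_p}` after translation by a
sufficiently positive element. -/
theorem exists_lift_of_fixed [CharZero E] (hπ : IsSmooth π) {w : JacquetModule π}
    (hw : w ∈ fixedBy (jacquet π) (IwIg p m)) :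
    ∃ s : ℕ, ∃ v ∈ fixedBy π (Iw p (m + 1)),
      jacquetMk π v = jacquet π (torusEltLevi p m (firstWeight m s)) w := by
  obtain ⟨v, rfl⟩ := Representation.Coinvariants.mk_surjective _ w
  change jacquetMk π v ∈ _ at hw
  obtain ⟨S, hS, hv⟩ := hπ v
  obtain ⟨s, hs⟩ := exists_conj_colUnip_mem hS
  set t := torusElt p (firstWeight m s) with ht
  obtain ⟨v', hv', hsub⟩ := exists_average (hπ.isLocallyFinite (isCompact_Iw p (m + 1)))
    (K := Iw p (m + 1) ⊓ parabolic p m) (π t v) fun x hx => by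
      -- Here `x = k n` with `k ∈ Iw_p ∩ P` and `n` opposite unipotent. By the choice of `s`, `t⁻¹ n
      -- t` fixes `v`, so `n` fixes `t v` and the average only sees `Iw_p ∩ P`.
      obtain ⟨c, hc, hc1, k, hk, hkP, hkx⟩ := exists_parabolic_mul_colUnip (mem_Iw.mp hx).1
      refine ⟨(k, x.2), ⟨mem_Iw.mpr ⟨hk, (mem_Iw.mp hx).2⟩, hkP⟩, ?_⟩
      have h1 : ((k, x.2)⁻¹ * x : GG p (m + 1)) = (colUnip 0 c hc, 1) := by
        refine Prod.ext ?_ ?_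
        · change k⁻¹ * x.1 = _
          rw [hkx, inv_mul_cancel_left]
        · exact inv_mul_cancel _
      have h2 := congrArg (π t) ((mem_fixedBy π).mp hv _ (hs c hc hc1))
      rw [← Module.End.mul_apply, ← map_mul, mul_assoc t⁻¹, mul_inv_cancel_left] at h2
      rw [h1, ← Module.End.mul_apply, ← map_mul]
      exact h2
  refine ⟨s, v', hv', ?_⟩
  refine fixed_eq_of_sub_mem hπ.isLocallyFinite_jacquet (jacquetMk_mem_fixedBy π hv')
    (apply_mem_fixedBy_of_comm (torusEltLevi_firstWeight_comm s) hw) ?_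
  have h3 := jacquetMk_mem_augmentation π hsub
  rw [ht, ← coe_leviEmb_torusEltLevi, map_sub, ← jacquet_jacquetMk] at h3
  exact h3

/-- Lift `t_s w` to `v`. By finite-dimensionality the injective Hecke operator of `t_s` is onto, so
`v` is the image of some `v'`; in `π_N` this reads `t_s w = c t_s v'`, and cancelling `t_s` shows
that `c v'` lifts `w`. -/
theorem jacquetMk_surjective [CharZero E] (hπ : IsAdmissible π) {w : JacquetModule π}
    (hw : w ∈ fixedBy (jacquet π) (IwIg p m)) :
    ∃ v ∈ fixedBy π (Iw p (m + 1)), jacquetMk π v = w := by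
  obtain ⟨s, v, hv, hvw⟩ := exists_lift_of_fixed hπ.1 hw
  have := hπ.2 _ (isOpen_Iw p (m + 1)) (isCompact_Iw p _)
  obtain ⟨v', hv'⟩ := (LinearMap.injective_iff_surjective.mp
    (heckeRep_firstWeight_injective hπ.1 s)) ⟨v, hv⟩
  set T := torusEltLevi p m (firstWeight m s) with hT
  set c : E := ((conjSubgroup (torusElt p (firstWeight m s)) (Iw p (m + 1))).relIndex
    (Iw p (m + 1)) : E) with hc
  have h1 : jacquetMk π v = c • jacquet π T (jacquetMk π v') := by
    refine fixed_eq_of_sub_mem hπ.1.isLocallyFinite_jacquet (jacquetMk_mem_fixedBy π hv)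
      (Submodule.smul_mem _ _ (apply_mem_fixedBy_of_comm (torusEltLevi_firstWeight_comm s)
        (jacquetMk_mem_fixedBy π v'.2))) ?_
    have h2 := jacquetMk_heckeOperator_sub_mem hπ.1 (firstWeight m s) v'
    have h3 : (heckeOperator π (Iw p (m + 1)) (torusElt p (firstWeight m s)) v' : V) = v :=
      congrArg Subtype.val hv'
    rwa [h3] at h2
  refine ⟨c • (v' : V), Submodule.smul_mem _ _ v'.2, eq_of_apply_eq (ρ := jacquet π) (g := T) ?_⟩
  rw [map_smul, map_smul, ← h1, hvw]

variable (π) in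
/-- The isomorphism `π^{Iw_p} ≃ π_N^{Iw_Ig}`. -/
def invariantsEquiv [CharZero E] (hπ : IsAdmissible π) :
    fixedBy π (Iw p (m + 1)) ≃ₗ[E] fixedBy (jacquet π) (IwIg p m) :=
  LinearEquiv.ofBijective
    ((jacquetMk π).restrict fun _ hv => jacquetMk_mem_fixedBy π hv) <| by
    refine ⟨(injective_iff_map_eq_zero _).mpr fun v hv => Subtype.ext
      (jacquetMk_injective hπ.1 v.2 (congrArg Subtype.val hv)), fun w => ?_⟩
    obtain ⟨v, hv, hvw⟩ := jacquetMk_surjective hπ w.2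
    exact ⟨⟨v, hv⟩, Subtype.ext hvw⟩

theorem invariantsEquiv_apply [CharZero E] (hπ : IsAdmissible π) (v : fixedBy π (Iw p (m + 1))) :
    (invariantsEquiv π hπ v : JacquetModule π) = jacquetMk π v := rfl

theorem invariantsEquiv_heckeRep [CharZero E] (hπ : IsAdmissible π) (u : Uminus (m + 1))
    (v : fixedBy π (Iw p (m + 1))) :
    invariantsEquiv π hπ (heckeRep π hπ.1 u v) =
      ((modularChar p m E (leviEmb p m (torusEltLevi p m u)))⁻¹ •
        heckeOperator (jacquet π) (IwIg p m) (torusEltLevi p m u)) (invariantsEquiv π hπ v) :=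
  Subtype.ext (jacquetMk_heckeOperator hπ.1 u v)

/-- A family of operators which corresponds to a representation under a linear equivalence is a
representation. -/
def representationOfEquiv {U W W' : Type*} [Monoid U] [AddCommGroup W] [Module E W]
    [AddCommGroup W'] [Module E W'] (A : Representation E U W) (e : W ≃ₗ[E] W')
    (F : U → Module.End E W') (h : ∀ u v, e (A u v) = F u (e v)) : Representation E U W' where
  toFun := F
  map_one' := by
    refine LinearMap.ext fun w => ?_
    obtain ⟨v, rfl⟩ := e.surjective w
    rw [← h, map_one]
    rfl
  map_mul' u u' := by
    refine LinearMap.ext fun w => ?_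
    obtain ⟨v, rfl⟩ := e.surjective w
    rw [Module.End.mul_apply, ← h, ← h, ← h, map_mul, Module.End.mul_apply]

variable (π) in
/-- The action of `U⁻` on `(π_N)^{Iw_Ig} ⊗ δ_P⁻¹`. -/
def heckeRepJacquet [CharZero E] (hπ : IsAdmissible π) :
    Representation E (Uminus (m + 1)) (fixedBy (jacquet π) (IwIg p m)) :=
  -- The operators on the Jacquet side satisfy the monoid relations because they correspond to those
  -- on `π^{Iw_p}`; no separate product formula in the Levi subgroup is required.
  representationOfEquiv (heckeRep π hπ.1) (invariantsEquiv π hπ)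
    (fun u => (modularChar p m E (leviEmb p m (torusEltLevi p m u)))⁻¹ •
      heckeOperator (jacquet π) (IwIg p m) (torusEltLevi p m u))
    (invariantsEquiv_heckeRep hπ)

end Bijective

end

end IwahoriJacquet

open IwahoriJacquet
theorem mainTheorem7 (p : ℕ) [Fact p.Prime] (m : ℕ) (hm : 1 ≤ m)
    {E : Type*} [Field E] [CharZero E] {V : Type*} [AddCommGroup V] [Module E V]
    (π : Representation E (GG p (m + 1)) V)
    (hirr : π.IsIrreducible) (hadm : IsAdmissible π) :
    ∃ (A : Representation E (Uminus (m + 1)) (fixedBy π (Iw p (m + 1))))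
      (A' : Representation E (Uminus (m + 1)) (fixedBy (jacquet π) (IwIg p m))),
      (∀ u, A u = heckeOperator π (Iw p (m + 1)) (torusElt p u)) ∧
      (∀ u, A' u = (modularChar p m E (leviEmb p m (torusEltLevi p m u)))⁻¹ •
        heckeOperator (jacquet π) (IwIg p m) (torusEltLevi p m u)) ∧
      ∃ e : A.Equiv A', ∀ v, (e v : JacquetModule π) = jacquetMk π v :=
  ⟨heckeRep π hadm.1, heckeRepJacquet π hadm, fun _ => rfl, fun _ => rfl,
    Representation.Equiv.mk (invariantsEquiv π hadm)
      fun u => LinearMap.ext fun v => invariantsEquiv_heckeRep hadm u v,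
    fun v => invariantsEquiv_apply hadm v⟩
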